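/- Let $\Gamma\subset\mathbb{C}$ be a rectifiable Jordan curve with length measure $|d\tau|$, and write $|E|$ for the length of a measurable set $E\subset\Gamma$. Let $t\in\Gamma$ and put \[ \Gamma(t,R)=\{\tau\in\Gamma:|\tau-t|<R\},\qquad \Delta(t,R)=\Gamma(t,R)\setminus\Gamma(t,R/2)\quad(R>0),\qquad d_t=\max_{\tau\in\Gamma}|\tau-t|. \] Suppose that $\Gamma$ is locally a Carleson curve at $t$, that is, $\sup_{R>0}|\Gamma(t,R)|/R<\infty$. Let $p:\Gamma\to(1,\infty)$ belong to $\mathcal{P}_t$: $p$ is continuous and there is a constant $A_t>0$ with $|p(\tau)-p(t)|\le A_t/(-\log|\tau-t|)$ for all $\tau\in\Gamma(t,1/2)$. For measurable $f:\Gamma\to[0,\infty]$ put \[ \|f\|_{L^{p(\cdot)}}=\inf\Big\{\lambda>0:\int_\Gamma\Big(\frac{f(\tau)}{\lambda}\Big)^{p(\tau)}|d\tau|\le1\Big\}\in[0,\infty], \] and let $\|g\|_{(L^{p(\cdot)})'}=\sup\{\int_\Gamma fg\,|d\tau| : f\ge0\text{ measurable},\ \|f\|_{L^{p(\cdot)}}\le1\}$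 be the associate norm. Let $w:\Gamma\to[0,\infty]$ be a weight (measurable, with $0<w<\infty$ a.e.) in the class $A_{L^{p(\cdot)}}(\Gamma,t)$, that is, \[ \sup_{R>0}\frac1R\,\|w\chi_{\Gamma(t,R)}\|_{L^{p(\cdot)}}\,\|\chi_{\Gamma(t,R)}/w\|_{(L^{p(\cdot)})'}<\infty . \] Write $\Omega_t(f,R)=|\Gamma(t,R)|^{-1}\int_{\Gamma(t,R)}f\,|d\tau|$ and, for $R_1,R_2\in(0,d_t]$, \[ H_w(R_1,R_2)=\frac{\exp\Omega_t(\log w,R_1)}{\exp\Omega_t(\log w,R_2)},\qquad G_w(R_1,R_2)=\frac{\|w\chi_{\Delta(t,R_1)}\|_{L^{p(\cdot)}}\,\|\chi_{\Delta(t,R_2)}/w\|_{(L^{p(\cdot)})'}}{|\Delta(t,R_2)|}, \] \[ (V_tw)(x)=\begin{cases}\sup_{0<R\le d_t}H_w(xR,R),&0<x\le1,\\ \sup_{0<R\le d_t}H_w(R,x^{-1}R),&x>1,\end{cases}\qquad (Q_tw)(x)=\begin{cases}\sup_{0<R\le d_t}G_w(xR,R),&0<x\le1,\\ \sup_{0<R\le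 d_t}G_w(R,x^{-1}R),&x>1.\end{cases} \] For $\Phi:(0,\infty)\to(0,\infty]$ put $\alpha(\Phi)=\sup_{0<x<1}\frac{\log\Phi(x)}{\log x}$ and $\beta(\Phi)=\inf_{x>1}\frac{\log\Phi(x)}{\log x}$. Then $\log w\in BMO(\Gamma,t)$, that is, $\log w\in L^1(\Gamma)$ and \[ \sup_{R>0}\frac1{|\Gamma(t,R)|}\int_{\Gamma(t,R)}|\log w(\tau)-\Omega_t(\log w,R)|\,|d\tau|<\infty ; \] the functions $Q_tw$ and $V_tw$ are regular (bounded in a neighbourhood of $1$) and submultiplicative ($\Phi(xy)\le\Phi(x)\Phi(y)$ for $x,y>0$), so that their indices are well defined, and these indices are finite; and \[ \alpha(Q_tw)=\frac1{p(t)}+\alpha(V_tw),\qquad \beta(Q_tw)=\frac1{p(t)}+\beta(V_tw). \] -/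

import Mathlib

open MeasureTheory Set Filter
open scoped ENNReal NNReal Topology

namespace NakanoCurve

noncomputable section

/-! ### The curve and its length measure -/

/-- `Γ` is a rectifiable Jordan curve in the plane: the image of a continuous closed parametrization
that is injective up to the coincidence of its end points and has finite length (total variation). -/
def IsRectifiableJordanCurve (Γ : Set ℂ) : Prop :=
  ∃ γ : ℝ → ℂ, ContinuousOn γ (Icc 0 1) ∧ InjOn γ (Ico 0 1) ∧ γ 0 = γ 1 ∧
    BoundedVariationOn γ (Icc 0 1) ∧ γ '' Icc 0 1 = Γ

/-- The length measure `|dτ|` on `Γ`: one-dimensional Hausdorff measure (in Mathlib's normalization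
it is Lebesgue measure on the line, and arc length on a rectifiable Jordan curve), carried by `Γ`.
Functions on `Γ` are functions on `ℂ`, of which only the values on `Γ` matter. -/
def lengthMeasure (Γ : Set ℂ) : Measure ℂ :=
  (Measure.hausdorffMeasure 1 : Measure ℂ).restrict Γ

/-- The portion `Γ(t,R) = {τ ∈ Γ : |τ - t| < R}`. -/
def portion (Γ : Set ℂ) (t : ℂ) (R : ℝ) : Set ℂ :=
  {τ | τ ∈ Γ ∧ ‖τ - t‖ < R}

/-- The annular portion `Δ(t,R) = Γ(t,R) \ Γ(t,R/2)`. -/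
def annulus (Γ : Set ℂ) (t : ℂ) (R : ℝ) : Set ℂ :=
  portion Γ t R \ portion Γ t (R / 2)

/-- `d_t = max {|τ - t| : τ ∈ Γ}`. -/
def maxDist (Γ : Set ℂ) (t : ℂ) : ℝ :=
  sSup ((fun τ : ℂ => ‖τ - t‖) '' Γ)

/-- `Γ` is locally a Carleson curve at `t`: the supremum of `|Γ(t,R)| / R` over `R > 0` is
finite. -/
def IsLocallyCarleson (Γ : Set ℂ) (t : ℂ) : Prop :=
  (⨆ (R : ℝ) (_ : 0 < R), lengthMeasure Γ (portion Γ t R) / ENNReal.ofReal R) < ∞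

/-! ### Weights, the Nakano norm and the associate norm -/

/-- A weight on `Γ`: measurable with respect to length measure, and `0 < w < ∞` almost
everywhere. -/
def IsWeight (Γ : Set ℂ) (w : ℂ → ℝ≥0∞) : Prop :=
  AEMeasurable w (lengthMeasure Γ) ∧ ∀ᵐ τ ∂(lengthMeasure Γ), 0 < w τ ∧ w τ < ∞

/-- The Luxemburg-Nakano norm of `L^{p(·)}` on non-negative functions,
`inf {l > 0 : ∫_Γ (f(τ)/l)^{p(τ)} |dτ| ≤ 1}`, equal to `∞` if there is no such `l`. -/
def nakanoNorm (Γ : Set ℂ) (p : ℂ → ℝ) (f : ℂ → ℝ≥0∞) : ℝ≥0∞ :=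
  ⨅ (l : ℝ≥0) (_ : 0 < l) (_ : ∫⁻ τ, (f τ / (l : ℝ≥0∞)) ^ (p τ) ∂(lengthMeasure Γ) ≤ 1),
    (l : ℝ≥0∞)

/-- The associate norm `ρ'` of a function norm `ρ` on the non-negative measurable functions:
`ρ'(g) = sup {∫_Γ f g |dτ| : f ≥ 0 measurable, ρ(f) ≤ 1}`. -/
def associateNorm (Γ : Set ℂ) (ρ : (ℂ → ℝ≥0∞) → ℝ≥0∞) (g : ℂ → ℝ≥0∞) : ℝ≥0∞ :=
  ⨆ (f : ℂ → ℝ≥0∞) (_ : AEMeasurable f (lengthMeasure Γ)) (_ : ρ f ≤ 1),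
    ∫⁻ τ, f τ * g τ ∂(lengthMeasure Γ)

/-- `‖w χ_E‖_X`, where `X` has the function norm `ρ`. -/
def weightNorm (ρ : (ℂ → ℝ≥0∞) → ℝ≥0∞) (w : ℂ → ℝ≥0∞) (E : Set ℂ) : ℝ≥0∞ :=
  ρ (E.indicator w)

/-- `‖χ_E / w‖_{X'}`, where `X` has the function norm `ρ`. -/
def invWeightNorm (Γ : Set ℂ) (ρ : (ℂ → ℝ≥0∞) → ℝ≥0∞) (w : ℂ → ℝ≥0∞) (E : Set ℂ) : ℝ≥0∞ :=
  associateNorm Γ ρ (E.indicator fun τ => (w τ)⁻¹)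

/-- The class `A_X(Γ,t)`, where `X` has the function norm `ρ`: the weights `w` for which the
supremum of `(1/R) ‖w χ_{Γ(t,R)}‖_X ‖χ_{Γ(t,R)} / w‖_{X'}` over `R > 0` is finite. -/
def MemAX (Γ : Set ℂ) (ρ : (ℂ → ℝ≥0∞) → ℝ≥0∞) (t : ℂ) (w : ℂ → ℝ≥0∞) : Prop :=
  IsWeight Γ w ∧
    (⨆ (R : ℝ) (_ : 0 < R),
      weightNorm ρ w (portion Γ t R) * invWeightNorm Γ ρ w (portion Γ t R) /
        ENNReal.ofReal R) < ∞

/-- The class `𝒫_t` of exponents: `p : Γ → (1,∞)` is continuous and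
`|p(τ) - p(t)| ≤ A / (-log |τ - t|)` for `τ ∈ Γ(t,1/2)`, with some constant `A > 0`. -/
def MemPt (Γ : Set ℂ) (t : ℂ) (p : ℂ → ℝ) : Prop :=
  ContinuousOn p Γ ∧ (∀ τ ∈ Γ, 1 < p τ) ∧
    ∃ A : ℝ, 0 < A ∧ ∀ τ ∈ portion Γ t (1 / 2), |p τ - p t| ≤ A / (-Real.log ‖τ - t‖)

/-! ### Mean oscillation -/

/-- The mean value `Ω_t(f,R)` of `f` over `Γ(t,R)`. -/
def mean (Γ : Set ℂ) (t : ℂ) (f : ℂ → ℝ) (R : ℝ) : ℝ :=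
  ⨍ τ in portion Γ t R, f τ ∂(lengthMeasure Γ)

/-- `f ∈ BMO(Γ,t)`: `f ∈ L¹(Γ)`, and the mean oscillations of `f` over the portions `Γ(t,R)`,
`R > 0`, are bounded. -/
def MemBMO (Γ : Set ℂ) (t : ℂ) (f : ℂ → ℝ) : Prop :=
  Integrable f (lengthMeasure Γ) ∧
    (⨆ (R : ℝ) (_ : 0 < R),
      (∫⁻ τ in portion Γ t R, ‖f τ - mean Γ t f R‖ₑ ∂(lengthMeasure Γ)) /
        lengthMeasure Γ (portion Γ t R)) < ∞

/-- `log w`, which is real-valued almost everywhere because `0 < w < ∞` almost everywhere. -/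
def logWeight (w : ℂ → ℝ≥0∞) : ℂ → ℝ :=
  fun τ => Real.log (w τ).toReal

/-! ### Submultiplicative functions and their indices -/

/-- `Φ : (0,∞) → (0,∞]` is regular: it is bounded in a neighbourhood of `1`. -/
def IsRegular (Φ : ℝ → ℝ≥0∞) : Prop :=
  ∃ M : ℝ≥0, ∀ᶠ x in 𝓝 (1 : ℝ), Φ x ≤ M

/-- `Φ : (0,∞) → (0,∞]` is submultiplicative. -/
def IsSubmultiplicative (Φ : ℝ → ℝ≥0∞) : Prop :=
  ∀ x y : ℝ, 0 < x → 0 < y → Φ (x * y) ≤ Φ x * Φ y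

/-- The lower index `α(Φ) = sup {log Φ(x) / log x : 0 < x < 1}`. -/
def lowerIndex (Φ : ℝ → ℝ≥0∞) : EReal :=
  ⨆ x ∈ Ioo (0 : ℝ) 1, ENNReal.log (Φ x) / (Real.log x : EReal)

/-- The upper index `β(Φ) = inf {log Φ(x) / log x : 1 < x < ∞}`. -/
def upperIndex (Φ : ℝ → ℝ≥0∞) : EReal :=
  ⨅ x ∈ Ioi (1 : ℝ), ENNReal.log (Φ x) / (Real.log x : EReal)

/-- The function on `(0,∞)` equal to `sup {F(xR, R) : 0 < R ≤ d}` for `x ≤ 1` and to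
`sup {F(R, R/x) : 0 < R ≤ d}` for `x > 1`. -/
def supRatio (d : ℝ) (F : ℝ → ℝ → ℝ≥0∞) (x : ℝ) : ℝ≥0∞ :=
  if x ≤ 1 then ⨆ R ∈ Ioc 0 d, F (x * R) R else ⨆ R ∈ Ioc 0 d, F R (x⁻¹ * R)

/-- `H_w(R₁,R₂) = exp(Ω_t(log w,R₁)) / exp(Ω_t(log w,R₂))`. -/
def fnH (Γ : Set ℂ) (t : ℂ) (w : ℂ → ℝ≥0∞) (R₁ R₂ : ℝ) : ℝ≥0∞ :=
  ENNReal.ofReal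
    (Real.exp (mean Γ t (logWeight w) R₁) / Real.exp (mean Γ t (logWeight w) R₂))

/-- The function `V_t w`. -/
def fnV (Γ : Set ℂ) (t : ℂ) (w : ℂ → ℝ≥0∞) : ℝ → ℝ≥0∞ :=
  supRatio (maxDist Γ t) (fnH Γ t w)

/-- `G_w(R₁,R₂) = ‖w χ_{Δ(t,R₁)}‖_X ‖χ_{Δ(t,R₂)} / w‖_{X'} / |Δ(t,R₂)|`, where `X` has the
function norm `ρ`. -/
def fnG (Γ : Set ℂ) (ρ : (ℂ → ℝ≥0∞) → ℝ≥0∞) (t : ℂ) (w : ℂ → ℝ≥0∞) (R₁ R₂ : ℝ) : ℝ≥0∞ :=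
  weightNorm ρ w (annulus Γ t R₁) * invWeightNorm Γ ρ w (annulus Γ t R₂) /
    lengthMeasure Γ (annulus Γ t R₂)

/-- The function `Q_t w`, formed with the space whose function norm is `ρ`. -/
def fnQ (Γ : Set ℂ) (ρ : (ℂ → ℝ≥0∞) → ℝ≥0∞) (t : ℂ) (w : ℂ → ℝ≥0∞) : ℝ → ℝ≥0∞ :=
  supRatio (maxDist Γ t) (fnG Γ ρ t w)

end

end NakanoCurve

/-!
The proof avoids the duality and the geometry of variable Lebesgue spaces: only two norms have to be
computed. The logarithmic continuity of `p` at `t` makes `R ^ p(τ)` comparable with `R ^ p(t)` for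
`τ ∈ Γ(t,R)`, and the Carleson condition gives `|Γ(t,R)| ≲ R`; hence
`‖χ_{Γ(t,R)}‖ ≲ R ^ (1/p(t))` and `‖χ_{Γ(t,R)}‖' ≲ R ^ (1 - 1/p(t))`
(`exists_modular_portion_le`, `exists_associateNorm_portion_le`). In the other direction the curve
is connected, so `|Δ(t,R)| ≥ R/2` for `R ≤ d_t` (`half_le_measure_annulus`).

By Hölder's inequality the class `A_X` at `t` is then contained in the Muckenhoupt class `A₂` at
`t`: `∫ w · ∫ 1/w ≲ R²` over `Γ(t,R)` (`MemAX.exists_lintegral_mul_lintegral_le`). Jensen's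
inequality turns this into a bound for the oscillation of `log w` (`MemAX.memBMO_logWeight`).

Write `Ω(R)` for the mean of `log w` over `Γ(t,R)`. Jensen's inequality on `Δ(t,R)`, where the mean
of `log w` differs from `Ω(R)` by a bounded amount, yields
`‖w χ_Δ‖ ≳ e ^ Ω(R) R ^ (1/p(t))` and `‖χ_Δ / w‖' ≳ e ^ (-Ω(R)) R ^ (1 - 1/p(t))`.
As the product of these norms is `≲ R`, both bounds are sharp (`MemAX.exists_annulus_bounds`).
Therefore `G_w(R₁,R₂) ≍ (R₁/R₂) ^ (1/p(t)) H_w(R₁,R₂)` (`MemAX.exists_fnG_bounds`), and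
`Q_t w (x) ≍ x ^ (1/p(t)) V_t w (x)`.

Finally `z ↦ log Φ(e ^ z)` is subadditive for submultiplicative `Φ`. Such a function bounded above
near `0` has finite growth rates at `±∞`, which do not see bounded perturbations; this gives the
finiteness of the indices and their shift by `1/p(t)` (`exists_indices_eq_add`).
-/

namespace NakanoCurve

/-! ### Length of the portions of the curve -/

section Geometry

variable {Γ : Set ℂ} {t : ℂ}

theorem IsRectifiableJordanCurve.isCompact (hΓ : IsRectifiableJordanCurve Γ) : IsCompact Γ := by
  obtain ⟨γ, hc, -, -, -, rfl⟩ := hΓ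
  exact isCompact_Icc.image_of_continuousOn hc

theorem IsRectifiableJordanCurve.isPreconnected (hΓ : IsRectifiableJordanCurve Γ) :
    IsPreconnected Γ := by
  obtain ⟨γ, hc, -, -, -, rfl⟩ := hΓ
  exact isPreconnected_Icc.image γ hc

theorem IsRectifiableJordanCurve.exists_ne (hΓ : IsRectifiableJordanCurve Γ) (t : ℂ) :
    ∃ τ ∈ Γ, τ ≠ t := by
  obtain ⟨γ, -, hi, -, -, rfl⟩ := hΓ
  have h0 : (0 : ℝ) ∈ Ico (0 : ℝ) 1 := by norm_num
  have h2 : (1 / 2 : ℝ) ∈ Ico (0 : ℝ) 1 := by norm_num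
  by_cases h : γ 0 = t
  · refine ⟨γ (1 / 2), mem_image_of_mem _ (Ico_subset_Icc_self h2), fun h' => ?_⟩
    have := hi h0 h2 (h.trans h'.symm)
    norm_num at this
  · exact ⟨γ 0, mem_image_of_mem _ (Ico_subset_Icc_self h0), h⟩

theorem norm_sub_le_maxDist (hΓ : IsCompact Γ) {τ : ℂ} (hτ : τ ∈ Γ) :
    ‖τ - t‖ ≤ maxDist Γ t :=
  le_csSup (hΓ.image (by fun_prop : Continuous fun τ : ℂ => ‖τ - t‖)).bddAbove
    (mem_image_of_mem _ hτ)

theorem maxDist_pos (hΓ : IsRectifiableJordanCurve Γ) (t : ℂ) : 0 < maxDist Γ t := by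
  obtain ⟨τ, hτ, hne⟩ := hΓ.exists_ne t
  exact (norm_pos_iff.2 (sub_ne_zero.2 hne)).trans_le (norm_sub_le_maxDist hΓ.isCompact hτ)

theorem exists_norm_sub_eq (hΓ : IsCompact Γ) (hc : IsPreconnected Γ) (ht : t ∈ Γ) {r : ℝ}
    (h0 : 0 ≤ r) (hr : r ≤ maxDist Γ t) : ∃ τ ∈ Γ, ‖τ - t‖ = r := by
  have hcont : Continuous fun τ : ℂ => ‖τ - t‖ := by fun_prop
  obtain ⟨σ, hσ, hσd⟩ := (hΓ.image hcont).sSup_mem ⟨_, mem_image_of_mem _ ht⟩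
  have := hc.intermediate_value ht hσ hcont.continuousOn
  exact this ⟨by simpa using h0, hr.trans_eq hσd.symm⟩

theorem portion_eq (Γ : Set ℂ) (t : ℂ) (R : ℝ) : portion Γ t R = Γ ∩ Metric.ball t R := by
  ext τ; simp [portion, dist_eq_norm]

theorem measurableSet_portion (hΓ : MeasurableSet Γ) (R : ℝ) : MeasurableSet (portion Γ t R) := by
  rw [portion_eq]; exact hΓ.inter measurableSet_ball

theorem measurableSet_annulus (hΓ : MeasurableSet Γ) (R : ℝ) : MeasurableSet (annulus Γ t R) :=
  (measurableSet_portion hΓ R).diff (measurableSet_portion hΓ _)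

theorem annulus_subset_portion (R : ℝ) : annulus Γ t R ⊆ portion Γ t R := sdiff_subset

theorem portion_mono {R S : ℝ} (h : R ≤ S) : portion Γ t R ⊆ portion Γ t S :=
  fun _ hτ => ⟨hτ.1, hτ.2.trans_le h⟩

theorem portion_eq_self (hΓ : IsCompact Γ) {R : ℝ} (hR : maxDist Γ t < R) :
    portion Γ t R = Γ :=
  Subset.antisymm (fun _ h => h.1) fun _ h => ⟨h, (norm_sub_le_maxDist hΓ h).trans_lt hR⟩

/-- The distance to `t` is `1`-Lipschitz and, the curve being connected, maps `Δ(t,R)` onto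
`[R/2, R)`. -/
theorem half_le_measure_annulus (hΓ : IsCompact Γ) (hc : IsPreconnected Γ) (ht : t ∈ Γ) {R : ℝ}
    (h0 : 0 < R) (hR : R ≤ maxDist Γ t) :
    ENNReal.ofReal (R / 2) ≤ lengthMeasure Γ (annulus Γ t R) := by
  have hsub : Ico (R / 2) R ⊆ (fun τ : ℂ => dist τ t) '' annulus Γ t R := by
    intro r hr
    obtain ⟨τ, hτ, rfl⟩ := exists_norm_sub_eq hΓ hc ht (by linarith [hr.1]) (hr.2.le.trans hR)
    exact ⟨τ, ⟨⟨hτ, hr.2⟩, fun h => absurd h.2 hr.1.not_gt⟩, dist_eq_norm _ _⟩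
  have hlip : LipschitzOnWith 1 (fun τ : ℂ => dist τ t) (annulus Γ t R) :=
    (LipschitzWith.dist_left t).lipschitzOnWith
  have h1 := hlip.hausdorffMeasure_image_le zero_le_one
  have h2 : lengthMeasure Γ (annulus Γ t R) = Measure.hausdorffMeasure 1 (annulus Γ t R) :=
    Measure.restrict_eq_self _ fun _ h => h.1.1
  rw [h2]
  calc ENNReal.ofReal (R / 2) = volume (Ico (R / 2) R) := by
        rw [Real.volume_Ico]; ring_nf
    _ = Measure.hausdorffMeasure 1 (Ico (R / 2) R) := by rw [hausdorffMeasure_real]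
    _ ≤ _ := measure_mono hsub
    _ ≤ _ := by simpa using h1

theorem IsLocallyCarleson.exists_measure_portion_le (hC : IsLocallyCarleson Γ t) :
    ∃ C : ℝ, 0 < C ∧ ∀ R, 0 < R → lengthMeasure Γ (portion Γ t R) ≤ ENNReal.ofReal (C * R) := by
  obtain ⟨C, hC⟩ := ENNReal.lt_iff_exists_nnreal_btwn.1 hC
  refine ⟨C + 1, by positivity, fun R hR => ?_⟩
  have h := (le_iSup₂ (f := fun (R : ℝ) (_ : 0 < R) =>
    lengthMeasure Γ (portion Γ t R) / ENNReal.ofReal R) R hR).trans hC.1.le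
  rw [ENNReal.div_le_iff (by simpa using hR) ENNReal.ofReal_ne_top] at h
  refine h.trans ?_
  rw [ENNReal.ofReal_mul (by positivity)]
  gcongr
  rw [← ENNReal.ofReal_coe_nnreal]
  exact ENNReal.ofReal_le_ofReal (by linarith)

theorem isFiniteMeasure_lengthMeasure (hΓ : IsCompact Γ) (hC : IsLocallyCarleson Γ t) :
    IsFiniteMeasure (lengthMeasure Γ) := by
  obtain ⟨C, -, h⟩ := hC.exists_measure_portion_le
  refine ⟨?_⟩
  have h1 := h (max (maxDist Γ t) 0 + 1) (by positivity)
  rw [portion_eq_self hΓ (by linarith [le_max_left (maxDist Γ t) 0])] at h1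
  have : lengthMeasure Γ univ = lengthMeasure Γ Γ := by simp [lengthMeasure]
  rw [this]
  exact h1.trans_lt ENNReal.ofReal_lt_top

theorem quarter_le_measure_portion (hΓ : IsCompact Γ) (hc : IsPreconnected Γ) (ht : t ∈ Γ) {R : ℝ}
    (h0 : 0 < R) (hR : R ≤ 2 * maxDist Γ t) :
    ENNReal.ofReal (R / 4) ≤ lengthMeasure Γ (portion Γ t R) :=
  calc ENNReal.ofReal (R / 4) = ENNReal.ofReal (R / 2 / 2) := by ring_nf
    _ ≤ lengthMeasure Γ (annulus Γ t (R / 2)) :=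
      half_le_measure_annulus hΓ hc ht (by linarith) (by linarith)
    _ ≤ _ := measure_mono ((annulus_subset_portion _).trans (portion_mono (by linarith)))

end Geometry

/-! ### Nakano norms and associate norms -/

section Norms

variable {Γ : Set ℂ} {t : ℂ} {p : ℂ → ℝ}

theorem ae_mem_lengthMeasure (hΓ : MeasurableSet Γ) : ∀ᵐ τ ∂(lengthMeasure Γ), τ ∈ Γ :=
  ae_restrict_mem hΓ

theorem nakanoNorm_le {f : ℂ → ℝ≥0∞} {l : ℝ≥0} (hl : 0 < l)
    (h : ∫⁻ τ, (f τ / (l : ℝ≥0∞)) ^ (p τ) ∂(lengthMeasure Γ) ≤ 1) : nakanoNorm Γ p f ≤ l :=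
  iInf_le_of_le l (iInf_le_of_le hl (iInf_le_of_le h le_rfl))

theorem nakanoNorm_mono (hΓ : MeasurableSet Γ) (hp : ∀ τ ∈ Γ, 0 ≤ p τ) {f g : ℂ → ℝ≥0∞}
    (hfg : ∀ τ, f τ ≤ g τ) : nakanoNorm Γ p f ≤ nakanoNorm Γ p g := by
  refine le_iInf fun l => le_iInf fun hl => le_iInf fun h => nakanoNorm_le hl (le_trans ?_ h)
  refine lintegral_mono_ae ?_
  filter_upwards [ae_mem_lengthMeasure hΓ] with τ hτ
  exact ENNReal.rpow_le_rpow (ENNReal.div_le_div_right (hfg τ) _) (hp τ hτ)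

theorem associateNorm_mono (Γ : Set ℂ) (ρ : (ℂ → ℝ≥0∞) → ℝ≥0∞) {f g : ℂ → ℝ≥0∞}
    (hfg : ∀ τ, f τ ≤ g τ) : associateNorm Γ ρ f ≤ associateNorm Γ ρ g :=
  iSup_mono fun _ => iSup_mono fun _ => iSup_mono fun _ =>
    lintegral_mono fun τ => mul_le_mul' le_rfl (hfg τ)

/-- The unit ball of the Nakano norm, up to a factor `2`, lies in the unit ball of the modular. -/
theorem lintegral_half_rpow_le_one (hΓ : MeasurableSet Γ) (hp : ∀ τ ∈ Γ, 0 ≤ p τ)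
    {f : ℂ → ℝ≥0∞} (hf : nakanoNorm Γ p f ≤ 1) :
    ∫⁻ τ, (f τ / 2) ^ (p τ) ∂(lengthMeasure Γ) ≤ 1 := by
  have h2 : nakanoNorm Γ p f < 2 := hf.trans_lt (by norm_num)
  simp only [nakanoNorm, iInf_lt_iff] at h2
  obtain ⟨l, hl, h, hl2⟩ := h2
  refine le_trans (lintegral_mono_ae ?_) h
  filter_upwards [ae_mem_lengthMeasure hΓ] with τ hτ
  exact ENNReal.rpow_le_rpow (ENNReal.div_le_div_left hl2.le _) (hp τ hτ)

/-- Hölder's inequality with an admissible constant `l` in place of the norm of `f`. -/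
theorem lintegral_mul_le_of_modular {f g : ℂ → ℝ≥0∞} (hf : AEMeasurable f (lengthMeasure Γ))
    {l : ℝ≥0} (hl : 0 < l) (h : ∫⁻ τ, (f τ / (l : ℝ≥0∞)) ^ (p τ) ∂(lengthMeasure Γ) ≤ 1) :
    ∫⁻ τ, f τ * g τ ∂(lengthMeasure Γ) ≤ l * associateNorm Γ (nakanoNorm Γ p) g := by
  have h1 : nakanoNorm Γ p (fun τ => f τ / l) ≤ 1 := by
    have := nakanoNorm_le (Γ := Γ) (p := p) (f := fun τ => f τ / l) one_pos (by simpa using h)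
    simpa using this
  have h2 : ∫⁻ τ, (f τ / l) * g τ ∂(lengthMeasure Γ) ≤ associateNorm Γ (nakanoNorm Γ p) g :=
    le_iSup_of_le (fun τ => f τ / l) (le_iSup_of_le (hf.div_const _) (le_iSup_of_le h1 le_rfl))
  have hl0 : (l : ℝ≥0∞) ≠ 0 := by exact_mod_cast hl.ne'
  calc ∫⁻ τ, f τ * g τ ∂(lengthMeasure Γ)
      = ∫⁻ τ, l * ((f τ / l) * g τ) ∂(lengthMeasure Γ) := by
        refine lintegral_congr fun τ => ?_
        rw [← mul_assoc, ENNReal.mul_div_cancel hl0 ENNReal.coe_ne_top]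
    _ = l * ∫⁻ τ, (f τ / l) * g τ ∂(lengthMeasure Γ) :=
        lintegral_const_mul' _ _ ENNReal.coe_ne_top
    _ ≤ _ := by gcongr

/-- Hölder's inequality, with a bound `c` for the associate norm. That `c` is neither `0` nor `∞`
excludes the product `0 * ∞`. -/
theorem lintegral_mul_le_nakanoNorm_mul {f g : ℂ → ℝ≥0∞} (hf : AEMeasurable f (lengthMeasure Γ))
    {c : ℝ≥0∞} (h0 : c ≠ 0) (hc : c ≠ ∞) (hg : associateNorm Γ (nakanoNorm Γ p) g ≤ c) :
    ∫⁻ τ, f τ * g τ ∂(lengthMeasure Γ) ≤ nakanoNorm Γ p f * c := by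
  rw [← ENNReal.div_le_iff h0 hc]
  refine le_iInf fun l => le_iInf fun hl => le_iInf fun h => ?_
  rw [ENNReal.div_le_iff h0 hc]
  exact (lintegral_mul_le_of_modular hf hl h).trans (mul_le_mul' le_rfl hg)

/-- The logarithmic modulus of continuity of `p` at `t` makes `R ^ p(τ)` comparable with
`R ^ p(t)` for `|τ - t| < R`. -/
theorem MemPt.exists_abs_mul_log_le (hΓ : IsCompact Γ) (ht : t ∈ Γ) (hp : MemPt Γ t p) (D : ℝ) :
    ∃ M : ℝ, 0 ≤ M ∧ ∀ R ∈ Ioc 0 D, ∀ τ ∈ portion Γ t R, |(p τ - p t) * Real.log R| ≤ M := by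
  obtain ⟨hc, h1, A, hA, hlog⟩ := hp
  obtain ⟨P, hP⟩ := (hΓ.image_of_continuousOn hc).isBounded.exists_norm_le
  have hP' : ∀ τ ∈ Γ, |p τ| ≤ P := fun τ hτ => hP _ (mem_image_of_mem _ hτ)
  have hP0 : 0 ≤ P := (abs_nonneg _).trans (hP' t ht)
  refine ⟨A + (P + P) * (Real.log 2 + |Real.log D|), ?_, fun R hR τ hτ => ?_⟩
  · have := Real.log_pos one_lt_two
    positivity
  have hR0 := hR.1
  have hl2 := Real.log_pos one_lt_two
  rw [abs_mul]
  rcases lt_or_ge R (1 / 2) with hR1 | hR1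
  · have hRlog : Real.log R < 0 := Real.log_neg hR0 (by linarith)
    suffices |p τ - p t| * |Real.log R| ≤ A by
      have : 0 ≤ (P + P) * (Real.log 2 + |Real.log D|) := by positivity
      linarith
    -- At `τ = t` the logarithmic bound is not needed: the left side vanishes.
    rcases eq_or_ne τ t with rfl | hne
    · simpa using hA.le
    have hn : 0 < ‖τ - t‖ := norm_pos_iff.2 (sub_ne_zero.2 hne)
    have hle : Real.log ‖τ - t‖ ≤ Real.log R := Real.log_le_log hn hτ.2.le
    have h2 := hlog τ ⟨hτ.1, hτ.2.trans hR1⟩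
    rw [le_div_iff₀ (by linarith)] at h2
    rw [abs_of_neg hRlog]
    exact (mul_le_mul_of_nonneg_left (by linarith) (abs_nonneg _)).trans h2
  · have h2 : |p τ - p t| ≤ P + P :=
      (abs_sub _ _).trans (add_le_add (hP' τ hτ.1) (hP' t ht))
    have h3 : |Real.log R| ≤ Real.log 2 + |Real.log D| := by
      rw [abs_le]
      have h4 : Real.log (1 / 2) ≤ Real.log R := Real.log_le_log (by norm_num) hR1
      have h5 : Real.log R ≤ Real.log D := Real.log_le_log hR0 hR.2
      rw [one_div, Real.log_inv] at h4
      constructor <;> linarith [abs_nonneg (Real.log D), le_abs_self (Real.log D)]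
    have := mul_le_mul h2 h3 (abs_nonneg _) (by linarith)
    linarith

/-- `‖χ_{Γ(t,R)}‖ ≤ K R ^ (1/p(t))`, stated through the modular. -/
theorem exists_modular_portion_le (hΓ : IsCompact Γ) (ht : t ∈ Γ) (hC : IsLocallyCarleson Γ t)
    (hp : MemPt Γ t p) (D : ℝ) : ∃ K : ℝ, 0 < K ∧ ∀ R ∈ Ioc 0 D,
      ∫⁻ τ, ((portion Γ t R).indicator 1 τ / ENNReal.ofReal (K * R ^ (1 / p t))) ^ (p τ)
        ∂(lengthMeasure Γ) ≤ 1 := by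
  obtain ⟨M, hM0, hM⟩ := hp.exists_abs_mul_log_le hΓ ht D
  obtain ⟨C, hC0, hC⟩ := hC.exists_measure_portion_le
  obtain ⟨-, h1, -⟩ := hp
  have hpt := h1 t ht
  -- `K ≥ 1` and `p ≥ 1` give `K ^ (-p(τ)) ≤ K⁻¹`; the second bound makes the modular at most `1`.
  set K := max 1 (C * Real.exp M) with hK
  have hK1 : 1 ≤ K := le_max_left _ _
  have hK0 : 0 < K := by linarith
  refine ⟨K, hK0, fun R hR => ?_⟩
  have hR0 := hR.1
  have hL0 : 0 < K * R ^ (1 / p t) := by positivity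
  have key : ∀ τ ∈ Γ, ((portion Γ t R).indicator 1 τ / ENNReal.ofReal (K * R ^ (1 / p t))) ^ (p τ)
      ≤ (portion Γ t R).indicator (fun _ => ENNReal.ofReal (Real.exp M / (K * R))) τ := by
    intro τ hτ
    have hpτ := h1 τ hτ
    by_cases hmem : τ ∈ portion Γ t R
    swap
    · simp [hmem, ENNReal.zero_rpow_of_pos (by linarith : 0 < p τ)]
    rw [indicator_of_mem hmem, indicator_of_mem hmem, Pi.one_apply, one_div,
      ← ENNReal.ofReal_inv_of_pos hL0, ENNReal.ofReal_rpow_of_pos (inv_pos.2 hL0)]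
    refine ENNReal.ofReal_le_ofReal ?_
    rw [← Real.exp_log (Real.rpow_pos_of_pos (inv_pos.2 hL0) (p τ)),
      ← Real.exp_log (by positivity : 0 < K * R), ← Real.exp_sub, Real.exp_le_exp,
      Real.log_rpow (inv_pos.2 hL0), Real.log_inv, Real.log_mul hK0.ne' (by positivity),
      Real.log_rpow hR0, Real.log_mul hK0.ne' hR0.ne']
    have h2 := (abs_le.1 (hM R hR τ hmem)).1
    have h3 : 0 ≤ (p τ - 1) * Real.log K :=
      mul_nonneg (by linarith) (Real.log_nonneg hK1)
    have h4 : -M ≤ (p τ - p t) * Real.log R * (1 / p t) := by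
      have h5 : (1 / p t) ≤ 1 := by rw [div_le_one (by linarith)]; linarith
      have h6 : 0 < 1 / p t := by positivity
      nlinarith
    have h5 : p τ * (1 / p t * Real.log R) =
        (p τ - p t) * Real.log R * (1 / p t) + Real.log R := by field_simp; ring
    nlinarith
  calc _ ≤ ∫⁻ τ, (portion Γ t R).indicator (fun _ => ENNReal.ofReal (Real.exp M / (K * R))) τ
        ∂(lengthMeasure Γ) := by
        refine lintegral_mono_ae ?_
        filter_upwards [ae_mem_lengthMeasure hΓ.measurableSet] with τ hτ using key τ hτ
    _ = ENNReal.ofReal (Real.exp M / (K * R)) * lengthMeasure Γ (portion Γ t R) :=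
        lintegral_indicator_const (measurableSet_portion hΓ.measurableSet R) _
    _ ≤ ENNReal.ofReal (Real.exp M / (K * R)) * ENNReal.ofReal (C * R) := by
        gcongr; exact hC R hR0
    _ = ENNReal.ofReal (C * Real.exp M / K) := by
        rw [← ENNReal.ofReal_mul (by positivity)]
        congr 1; field_simp
    _ ≤ 1 := by
        rw [ENNReal.ofReal_le_one, div_le_one hK0]
        exact le_max_right _ _

/-- `‖χ_{Γ(t,R)}‖' ≤ K R ^ (1 - 1/p(t))`. Instead of the conjugate exponent, the elementary
inequality `x ≤ 1 + x ^ p` is used at scale `s = R ^ (-1/p(t))`. -/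
theorem exists_associateNorm_portion_le (hΓ : IsCompact Γ) (ht : t ∈ Γ)
    (hC : IsLocallyCarleson Γ t) (hp : MemPt Γ t p) (D : ℝ) : ∃ K : ℝ, 0 < K ∧ ∀ R ∈ Ioc 0 D,
      associateNorm Γ (nakanoNorm Γ p) ((portion Γ t R).indicator 1) ≤
        ENNReal.ofReal (K * R ^ (1 - 1 / p t)) := by
  obtain ⟨M, hM0, hM⟩ := hp.exists_abs_mul_log_le hΓ ht D
  obtain ⟨C, hC0, hC⟩ := hC.exists_measure_portion_le
  obtain ⟨-, h1, -⟩ := hp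
  have hpt := h1 t ht
  refine ⟨2 * (C + Real.exp M), by positivity, fun R hR => ?_⟩
  have hR0 := hR.1
  refine iSup_le fun f => iSup_le fun hf => iSup_le fun hf1 => ?_
  have hmod := lintegral_half_rpow_le_one hΓ.measurableSet
    (fun τ hτ => (zero_lt_one.trans (h1 τ hτ)).le) hf1
  set s : ℝ := R ^ (-(1 / p t)) with hs
  have hs0 : 0 < s := by positivity
  have key : ∀ τ ∈ Γ, f τ * (portion Γ t R).indicator 1 τ ≤
      2 * ((portion Γ t R).indicator (fun _ => ENNReal.ofReal s) τ +
        ENNReal.ofReal (s * (R * Real.exp M)) * (f τ / 2) ^ (p τ)) := by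
    intro τ hτ
    have hpτ := h1 τ hτ
    by_cases hmem : τ ∈ portion Γ t R
    swap
    · simp [hmem]
    rw [indicator_of_mem hmem, indicator_of_mem hmem, Pi.one_apply, mul_one]
    have hf2 : f τ = 2 * (f τ / 2) := (ENNReal.mul_div_cancel (by norm_num) (by norm_num)).symm
    have h2 : f τ / 2 ≤ ENNReal.ofReal s +
        ENNReal.ofReal (s * (R * Real.exp M)) * (f τ / 2) ^ (p τ) := by
      set x := f τ / 2
      rcases le_total x (ENNReal.ofReal s) with hx | hx
      · exact hx.trans le_self_add
      refine le_trans ?_ le_add_self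
      have h3 : x ≤ ENNReal.ofReal s * (x / ENNReal.ofReal s) ^ (p τ) := by
        have h4 : 1 ≤ x / ENNReal.ofReal s := by
          rw [ENNReal.le_div_iff_mul_le (by simp [hs0]) (by simp)]; simpa using hx
        calc x = ENNReal.ofReal s * (x / ENNReal.ofReal s) :=
              (ENNReal.mul_div_cancel (by simpa using hs0) (by simp)).symm
          _ = ENNReal.ofReal s * (x / ENNReal.ofReal s) ^ (1 : ℝ) := by rw [ENNReal.rpow_one]
          _ ≤ _ := by gcongr
      refine h3.trans ?_
      rw [ENNReal.div_eq_inv_mul, ENNReal.mul_rpow_of_nonneg _ _ (by linarith), ← mul_assoc,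
        ← ENNReal.ofReal_inv_of_pos hs0, ENNReal.ofReal_rpow_of_pos (inv_pos.2 hs0),
        ← ENNReal.ofReal_mul hs0.le]
      gcongr
      rw [← Real.exp_log (Real.rpow_pos_of_pos (inv_pos.2 hs0) (p τ)), ← Real.exp_log hR0,
        ← Real.exp_add, Real.exp_le_exp, Real.log_rpow (inv_pos.2 hs0), Real.log_inv, hs,
        Real.log_rpow hR0]
      have h2 := (abs_le.1 (hM R hR τ hmem)).2
      have h4 : (p τ - p t) * Real.log R * (1 / p t) ≤ M := by
        have h5 : (1 / p t) ≤ 1 := by rw [div_le_one (by linarith)]; linarith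
        have h6 : 0 < 1 / p t := by positivity
        nlinarith
      have h5 : p τ * -(-(1 / p t) * Real.log R) =
          (p τ - p t) * Real.log R * (1 / p t) + Real.log R := by field_simp; ring
      linarith
    calc f τ = 2 * (f τ / 2) := hf2
      _ ≤ _ := by gcongr
  calc _ ≤ ∫⁻ τ, 2 * ((portion Γ t R).indicator (fun _ => ENNReal.ofReal s) τ +
        ENNReal.ofReal (s * (R * Real.exp M)) * (f τ / 2) ^ (p τ)) ∂(lengthMeasure Γ) := by
        refine lintegral_mono_ae ?_
        filter_upwards [ae_mem_lengthMeasure hΓ.measurableSet] with τ hτ using key τ hτ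
    _ = 2 * (ENNReal.ofReal s * lengthMeasure Γ (portion Γ t R) +
        ENNReal.ofReal (s * (R * Real.exp M)) *
          ∫⁻ τ, (f τ / 2) ^ (p τ) ∂(lengthMeasure Γ)) := by
        have hm := measurableSet_portion (t := t) hΓ.measurableSet R
        rw [lintegral_const_mul' _ _ (by norm_num),
          lintegral_add_left (measurable_const.indicator hm), lintegral_indicator_const hm,
          lintegral_const_mul' _ _ ENNReal.ofReal_ne_top]
    _ ≤ 2 * (ENNReal.ofReal s * ENNReal.ofReal (C * R) +
        ENNReal.ofReal (s * (R * Real.exp M)) * 1) := by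
        gcongr; exact hC R hR0
    _ = ENNReal.ofReal (2 * (C + Real.exp M) * R ^ (1 - 1 / p t)) := by
        rw [mul_one, ← ENNReal.ofReal_mul hs0.le, ← ENNReal.ofReal_add (by positivity)
          (by positivity), ← ENNReal.ofReal_ofNat 2, ← ENNReal.ofReal_mul (by norm_num)]
        congr 1
        rw [sub_eq_add_neg, Real.rpow_add hR0, Real.rpow_one, ← hs]
        ring

end Norms

/-! ### Mean oscillation of logarithms -/

section Oscillation

variable {α : Type*} [MeasurableSpace α] {ν : Measure α}

/-- The exponential of the mean is at most the mean of the exponential. -/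
theorem exp_integral_le [IsProbabilityMeasure ν] {f : α → ℝ} (hf : Integrable f ν)
    (he : Integrable (fun x => Real.exp (f x)) ν) :
    Real.exp (∫ x, f x ∂ν) ≤ ∫ x, Real.exp (f x) ∂ν :=
  convexOn_exp.map_integral_le Real.continuous_exp.continuousOn isClosed_univ
    (Eventually.of_forall fun _ => mem_univ _) hf he

theorem integrable_of_integrable_exp [IsFiniteMeasure ν] {f : α → ℝ}
    (hf : AEStronglyMeasurable f ν) (h1 : Integrable (fun x => Real.exp (f x)) ν)
    (h2 : Integrable (fun x => Real.exp (-f x)) ν) : Integrable f ν := by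
  refine (h1.add h2).mono' hf (Eventually.of_forall fun x => ?_)
  have a := Real.add_one_le_exp (f x)
  have b := Real.add_one_le_exp (-f x)
  have c := Real.exp_pos (f x)
  have d := Real.exp_pos (-f x)
  simp only [Pi.add_apply, Real.norm_eq_abs]
  exact abs_le.2 ⟨by linarith, by linarith⟩

/-- If `a` and `b` are the means of `e ^ f` and `e ^ (-f)`, Jensen's inequality bounds both
`a e ^ (-m)` and `b e ^ m` by `ab`, `m` being the mean of `f`; their sum dominates the mean
of `|f - m|`. -/
theorem integral_abs_sub_integral_le [IsProbabilityMeasure ν] {f : α → ℝ}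
    (hf : AEStronglyMeasurable f ν) (h1 : Integrable (fun x => Real.exp (f x)) ν)
    (h2 : Integrable (fun x => Real.exp (-f x)) ν) :
    ∫ x, |f x - ∫ y, f y ∂ν| ∂ν ≤
      2 * ((∫ x, Real.exp (f x) ∂ν) * ∫ x, Real.exp (-f x) ∂ν) := by
  have hi := integrable_of_integrable_exp hf h1 h2
  have j1 := exp_integral_le hi h1
  have j2 := exp_integral_le hi.neg h2
  simp only [Pi.neg_apply, integral_neg] at j2
  set m := ∫ y, f y ∂ν
  set a := ∫ x, Real.exp (f x) ∂ν
  set b := ∫ x, Real.exp (-f x) ∂ν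
  have ha : 0 < a := (Real.exp_pos _).trans_le j1
  have hb : 0 < b := (Real.exp_pos _).trans_le j2
  have hint : Integrable
      (fun x => Real.exp (-m) * Real.exp (f x) + Real.exp m * Real.exp (-f x)) ν :=
    (h1.const_mul _).add (h2.const_mul _)
  calc ∫ x, |f x - m| ∂ν
      ≤ ∫ x, (Real.exp (-m) * Real.exp (f x) + Real.exp m * Real.exp (-f x)) ∂ν := by
        refine integral_mono (hi.sub (integrable_const m)).abs hint fun x => ?_
        simp only [← Real.exp_add]
        have p1 := Real.add_one_le_exp (-m + f x)
        have p2 := Real.add_one_le_exp (m + -f x)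
        have p3 := Real.exp_pos (-m + f x)
        have p4 := Real.exp_pos (m + -f x)
        exact abs_le.2 ⟨by linarith, by linarith⟩
    _ = Real.exp (-m) * a + Real.exp m * b := by
        rw [integral_add (h1.const_mul _) (h2.const_mul _), integral_const_mul, integral_const_mul]
    _ ≤ b * a + a * b := by gcongr
    _ = _ := by ring

theorem integral_abs_sub_average_le [IsFiniteMeasure ν] [NeZero ν] {f : α → ℝ}
    (hf : AEStronglyMeasurable f ν) (h1 : Integrable (fun x => Real.exp (f x)) ν)
    (h2 : Integrable (fun x => Real.exp (-f x)) ν) :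
    ∫ x, |f x - ⨍ y, f y ∂ν| ∂ν ≤
      2 * ((∫ x, Real.exp (f x) ∂ν) * ∫ x, Real.exp (-f x) ∂ν) / ν.real univ := by
  have hpos : 0 < ν.real univ := measureReal_univ_pos
  have hc : (ν univ)⁻¹ ≠ ∞ := ENNReal.inv_ne_top.2 (NeZero.ne _)
  have key := integral_abs_sub_integral_le (ν := (ν univ)⁻¹ • ν) (hf.smul_measure _)
    (h1.smul_measure hc) (h2.smul_measure hc)
  change (⨍ x, |f x - ⨍ y, f y ∂ν| ∂ν) ≤
    2 * ((⨍ x, Real.exp (f x) ∂ν) * ⨍ x, Real.exp (-f x) ∂ν) at key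
  rw [average_eq (f := fun x => |f x - ⨍ y, f y ∂ν|), average_eq (f := fun x => Real.exp (f x)),
    average_eq (f := fun x => Real.exp (-f x))] at key
  simp only [smul_eq_mul] at key
  rw [le_div_iff₀ hpos]
  rw [inv_mul_le_iff₀ hpos] at key
  refine (mul_le_mul_of_nonneg_right key hpos.le).trans_eq ?_
  field_simp

theorem mul_exp_average_le [IsFiniteMeasure ν] [NeZero ν] {f : α → ℝ} (hf : Integrable f ν)
    (he : Integrable (fun x => Real.exp (f x)) ν) :
    ν.real univ * Real.exp (⨍ x, f x ∂ν) ≤ ∫ x, Real.exp (f x) ∂ν := by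
  have h := convexOn_exp.map_average_le Real.continuous_exp.continuousOn isClosed_univ
    (Eventually.of_forall fun _ => mem_univ _) hf he
  rw [average_eq (f := fun x => Real.exp (f x)), smul_eq_mul, ← div_eq_inv_mul,
    le_div_iff₀ measureReal_univ_pos] at h
  linarith

/-- The mean over a part of the space, of measure at least `c`, is close to the total mean. -/
theorem abs_average_sub_le [IsFiniteMeasure ν] {f : α → ℝ} (hf : Integrable f ν) {E : Set α}
    {c B m : ℝ} (hc : 0 < c) (hE : c ≤ ν.real E)
    (hB : ∫ x, |f x - m| ∂ν ≤ B) : |(⨍ x in E, f x ∂ν) - m| ≤ B / c := by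
  have hE0 : 0 < ν.real E := hc.trans_le hE
  have hi : Integrable (fun x => f x - m) ν := hf.sub (integrable_const m)
  have e : (⨍ x in E, f x ∂ν) - m = (ν.real E)⁻¹ * ∫ x in E, (f x - m) ∂ν := by
    rw [setAverage_eq, integral_sub hf.integrableOn (integrable_const m), setIntegral_const]
    simp only [smul_eq_mul]
    field_simp
  rw [e, abs_mul, abs_of_pos (inv_pos.2 hE0), inv_mul_eq_div]
  have h1 : |∫ x in E, (f x - m) ∂ν| ≤ B :=
    (abs_integral_le_integral_abs).trans ((setIntegral_le_integral hi.abs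
      (Eventually.of_forall fun _ => abs_nonneg _)).trans hB)
  exact div_le_div₀ ((abs_nonneg _).trans h1) h1 hc hE

end Oscillation

/-! ### Submultiplicative functions and their indices -/

section Indices

/-- For `xy ≤ 1` the intermediate radius is `xR` with `x ≤ 1`; for `xy > 1` it is `R / y` with
`y > 1`. Both choices stay within `(0,d]`. -/
theorem isSubmultiplicative_supRatio {d : ℝ} {F : ℝ → ℝ → ℝ≥0∞}
    (hF : ∀ R₁ ∈ Ioc 0 d, ∀ R₂ ∈ Ioc 0 d, ∀ R₃ ∈ Ioc 0 d, F R₁ R₃ ≤ F R₁ R₂ * F R₂ R₃) :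
    IsSubmultiplicative (supRatio d F) := by
  have hle : ∀ x R, x ≤ 1 → R ∈ Ioc 0 d → F (x * R) R ≤ supRatio d F x := by
    intro x R hx hR
    rw [supRatio, if_pos hx]
    exact le_iSup₂ (f := fun R (_ : R ∈ Ioc 0 d) => F (x * R) R) R hR
  have hge : ∀ x R, 1 < x → R ∈ Ioc 0 d → F R (x⁻¹ * R) ≤ supRatio d F x := by
    intro x R hx hR
    rw [supRatio, if_neg hx.not_ge]
    exact le_iSup₂ (f := fun R (_ : R ∈ Ioc 0 d) => F R (x⁻¹ * R)) R hR
  have hsc : ∀ x R, 0 < x → x ≤ 1 → R ∈ Ioc 0 d → x * R ∈ Ioc 0 d := fun x R h0 h1 hR =>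
    ⟨mul_pos h0 hR.1, (mul_le_of_le_one_left hR.1.le h1).trans hR.2⟩
  have hlt : ∀ x y, 0 < x → 0 < y → x ≤ 1 → 1 < y →
      supRatio d F (x * y) ≤ supRatio d F x * supRatio d F y := by
    intro x y hx hy hx1 hy1
    by_cases hxy : x * y ≤ 1
    · rw [supRatio, if_pos hxy]
      refine iSup₂_le fun R hR => ?_
      have hm := hsc _ _ (mul_pos hx hy) hxy hR
      have h1 := hge y _ hy1 hm
      have h2 := hle x R hx1 hR
      have e : y⁻¹ * (x * y * R) = x * R := by field_simp
      rw [e] at h1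
      rw [mul_comm (supRatio d F x)]
      exact (hF _ hm _ (hsc _ _ hx hx1 hR) _ hR).trans (mul_le_mul' h1 h2)
    · rw [supRatio, if_neg hxy]
      refine iSup₂_le fun R hR => ?_
      have hm := hsc _ _ (inv_pos.2 (mul_pos hx hy)) (inv_le_one_of_one_le₀ (not_le.1 hxy).le) hR
      have h1 := hge y R hy1 hR
      have h2 := hle x _ hx1 hm
      have e : x * ((x * y)⁻¹ * R) = y⁻¹ * R := by field_simp
      rw [e] at h2
      rw [mul_comm (supRatio d F x)]
      exact (hF _ hR _ (hsc _ _ (inv_pos.2 hy) (inv_le_one_of_one_le₀ hy1.le) hR) _ hm).trans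
        (mul_le_mul' h1 h2)
  intro x y hx hy
  rcases le_or_gt x 1 with hx1 | hx1 <;> rcases le_or_gt y 1 with hy1 | hy1
  · have hxy : x * y ≤ 1 := mul_le_one₀ hx1 hy.le hy1
    rw [supRatio, if_pos hxy]
    refine iSup₂_le fun R hR => ?_
    have hm := hsc _ _ hy hy1 hR
    have h1 := hle x _ hx1 hm
    rw [← mul_assoc] at h1
    exact (hF _ (hsc _ _ (mul_pos hx hy) hxy hR) _ hm _ hR).trans (mul_le_mul' h1 (hle y R hy1 hR))
  · exact hlt x y hx hy hx1 hy1
  · rw [mul_comm x, mul_comm (supRatio d F x)]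
    exact hlt y x hy hx hy1 hx1
  · have hxy : 1 < x * y := one_lt_mul_of_lt_of_le hx1 hy1.le
    rw [supRatio, if_neg hxy.not_ge]
    refine iSup₂_le fun R hR => ?_
    have hm := hsc _ _ (inv_pos.2 hx) (inv_le_one_of_one_le₀ hx1.le) hR
    have h1 := hge y _ hy1 hm
    have e : y⁻¹ * (x⁻¹ * R) = (x * y)⁻¹ * R := by field_simp
    rw [e] at h1
    exact (hF _ hR _ hm _ (hsc _ _ (inv_pos.2 (mul_pos hx hy))
      (inv_le_one_of_one_le₀ hxy.le) hR)).trans (mul_le_mul' (hge x R hx1 hR) h1)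

/-- `supRatio d F x` only involves pairs of radii in `(0,d]` with ratio `x`, so a bound depending on
that ratio passes to the suprema. -/
theorem supRatio_le_mul {d : ℝ} {F F' : ℝ → ℝ → ℝ≥0∞} {c : ℝ → ℝ≥0∞}
    (h : ∀ R₁ ∈ Ioc 0 d, ∀ R₂ ∈ Ioc 0 d, F R₁ R₂ ≤ c (R₁ / R₂) * F' R₁ R₂) {x : ℝ} (hx : 0 < x) :
    supRatio d F x ≤ c x * supRatio d F' x := by
  by_cases hx1 : x ≤ 1
  · rw [supRatio, supRatio, if_pos hx1, if_pos hx1]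
    refine iSup₂_le fun R hR => ?_
    have := h (x * R) ⟨mul_pos hx hR.1, (mul_le_of_le_one_left hR.1.le hx1).trans hR.2⟩ R hR
    rw [mul_div_cancel_right₀ _ hR.1.ne'] at this
    refine this.trans ?_
    gcongr
    exact le_iSup₂ (f := fun R (_ : R ∈ Ioc 0 d) => F' (x * R) R) R hR
  · rw [supRatio, supRatio, if_neg hx1, if_neg hx1]
    refine iSup₂_le fun R hR => ?_
    have hx' : x⁻¹ ≤ 1 := inv_le_one_of_one_le₀ (not_le.1 hx1).le
    have := h R hR (x⁻¹ * R) ⟨mul_pos (inv_pos.2 hx) hR.1,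
      (mul_le_of_le_one_left hR.1.le hx').trans hR.2⟩
    have e : R / (x⁻¹ * R) = x := by have := hR.1.ne'; field_simp
    rw [e] at this
    refine this.trans ?_
    gcongr
    exact le_iSup₂ (f := fun R (_ : R ∈ Ioc 0 d) => F' R (x⁻¹ * R)) R hR

/-- The infimum of `g y / y` over `y > 0`: for subadditive `g`, its linear growth rate at `∞`. It is
taken in `ℝ`, so it is meaningful only where `g y / y` is bounded below; see `isGLB_growthRate`. -/
noncomputable def growthRate (g : ℝ → ℝ) : ℝ := sInf ((fun y => g y / y) '' Ioi 0)

theorem nsmul_le_of_subadditive {g : ℝ → ℝ} (hg : ∀ x y, g (x + y) ≤ g x + g y) (n : ℕ) (y : ℝ) :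
    g ((n + 1) * y) ≤ (n + 1) * g y := by
  induction n with
  | zero => simp
  | succ n ih =>
    have := hg ((n + 1) * y) y
    push_cast
    have e : ((n : ℝ) + 1 + 1) * y = (n + 1) * y + y := by ring
    rw [e]; linarith

/-- A subadditive function bounded above on a symmetric interval is bounded above by an affine
function of `|z|`: write `z` as a sum of equal pieces lying in the interval. -/
theorem le_linear_of_subadditive {g : ℝ → ℝ} (hg : ∀ x y, g (x + y) ≤ g x + g y) {δ M : ℝ}
    (hδ : 0 < δ) (hM : ∀ z, |z| ≤ δ → g z ≤ M) (z : ℝ) : g z ≤ |M| / δ * |z| + |M| := by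
  set n := ⌊|z| / δ⌋₊
  have hn : |z| / δ < n + 1 := Nat.lt_floor_add_one _
  have hn' : (n : ℝ) ≤ |z| / δ := Nat.floor_le (by positivity)
  have hpos : (0 : ℝ) < n + 1 := by positivity
  have h1 := nsmul_le_of_subadditive hg n (z / (n + 1))
  rw [mul_div_cancel₀ _ hpos.ne'] at h1
  have h2 : g (z / (n + 1)) ≤ |M| := by
    refine (hM _ ?_).trans (le_abs_self M)
    rw [abs_div, abs_of_pos hpos, div_le_iff₀ hpos]
    rw [div_lt_iff₀ hδ] at hn
    linarith
  calc g z ≤ (n + 1) * g (z / (n + 1)) := h1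
    _ ≤ (n + 1) * |M| := by gcongr
    _ ≤ (|z| / δ + 1) * |M| := by gcongr
    _ = _ := by ring

theorem le_of_forall_le_add_div {a b K : ℝ} (h : ∀ n : ℕ, a ≤ b + K / (n + 1)) : a ≤ b := by
  have : Tendsto (fun n : ℕ => b + K / ((n : ℝ) + 1)) atTop (𝓝 (b + 0)) :=
    tendsto_const_nhds.add (tendsto_const_div_atTop_nhds_zero_nat K
      |>.comp (tendsto_add_atTop_nat 1) |>.congr fun n => by simp)
  rw [add_zero] at this
  exact ge_of_tendsto' this h

/-- If `g` is subadditive, a lower bound of slope `c` up to an additive constant bounds `g y / y` by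
`c`: apply it at the multiples of `y`. -/
theorem mul_le_of_subadditive {g : ℝ → ℝ} (hg : ∀ x y, g (x + y) ≤ g x + g y) {c K y : ℝ}
    (hy : 0 < y) (h : ∀ z, 0 < z → c * z - K ≤ g z) : c ≤ g y / y := by
  refine le_of_forall_le_add_div (K := K / y) fun n => ?_
  have hpos : (0 : ℝ) < n + 1 := by positivity
  have h1 := (h _ (mul_pos hpos hy)).trans (nsmul_le_of_subadditive hg n y)
  rw [div_div, ← sub_le_iff_le_add, le_div_iff₀ hy, sub_mul]
  have e : K / (y * (n + 1)) * y = K / (n + 1) := by field_simp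
  rw [e]
  have h2 : (c * y - K / (n + 1)) * (n + 1) ≤ g y * (n + 1) := by
    have : (c * y - K / (n + 1)) * (n + 1) = c * ((n + 1) * y) - K := by field_simp
    rw [this]; linarith
  exact le_of_mul_le_mul_right h2 hpos

theorem isGLB_growthRate {g : ℝ → ℝ} (hg : ∀ x y, g (x + y) ≤ g x + g y) {δ M : ℝ}
    (hδ : 0 < δ) (hM : ∀ z, |z| ≤ δ → g z ≤ M) :
    IsGLB ((fun y => g y / y) '' Ioi 0) (growthRate g) := by
  refine isGLB_csInf ⟨_, mem_image_of_mem _ (mem_Ioi.2 one_pos)⟩ ⟨-(|M| / δ), ?_⟩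
  rintro _ ⟨y, hy, rfl⟩
  refine mul_le_of_subadditive hg (K := |M|) hy fun z hz => ?_
  -- `0 ≤ g 0 ≤ g z + g (-z)` turns the linear upper bound at `-z` into a lower bound at `z`.
  have h0 : 0 ≤ g 0 := by have := hg 0 0; simp at this; exact this
  have h1 := hg z (-z)
  have h2 := le_linear_of_subadditive hg hδ hM (-z)
  rw [abs_neg, abs_of_pos hz] at h2
  rw [add_neg_cancel] at h1
  linarith

theorem growthRate_le_add {g h : ℝ → ℝ} (hh : ∀ x y, h (x + y) ≤ h x + h y)
    {a b : ℝ} (ha : IsGLB ((fun y => g y / y) '' Ioi 0) a)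
    (hb : IsGLB ((fun y => h y / y) '' Ioi 0) b) {s K : ℝ}
    (hgh : ∀ z, 0 < z → g z ≤ s * z + h z + K) : a ≤ s + b := by
  suffices a - s ≤ b by linarith
  refine hb.2 ?_
  rintro _ ⟨y, hy, rfl⟩
  refine mul_le_of_subadditive hh (K := K) hy fun z hz => ?_
  have h1 := ha.1 (mem_image_of_mem _ hz)
  rw [le_div_iff₀ hz] at h1
  linarith [hgh z hz]

/-- The logarithm of `Φ` in the variable `log x`. -/
noncomputable def logFun (Φ : ℝ → ℝ≥0∞) (z : ℝ) : ℝ := Real.log (Φ (Real.exp z)).toReal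

theorem logFun_add_le {Φ : ℝ → ℝ≥0∞} (hΦ : IsSubmultiplicative Φ)
    (h0 : ∀ x, 0 < x → Φ x ≠ 0) (ht : ∀ x, 0 < x → Φ x ≠ ∞) (x y : ℝ) :
    logFun Φ (x + y) ≤ logFun Φ x + logFun Φ y := by
  have hx := Real.exp_pos x
  have hy := Real.exp_pos y
  have hp : ∀ z, 0 < z → 0 < (Φ z).toReal := fun z hz => ENNReal.toReal_pos (h0 z hz) (ht z hz)
  rw [logFun, logFun, logFun, ← Real.log_mul (hp _ hx).ne' (hp _ hy).ne', ← ENNReal.toReal_mul,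
    Real.exp_add]
  refine Real.log_le_log (hp _ (mul_pos hx hy)) (ENNReal.toReal_mono ?_ (hΦ _ _ hx hy))
  exact ENNReal.mul_ne_top (ht _ hx) (ht _ hy)

theorem exists_logFun_le {Φ : ℝ → ℝ≥0∞} (hr : IsRegular Φ) (h0 : ∀ x, 0 < x → Φ x ≠ 0) :
    ∃ δ M : ℝ, 0 < δ ∧ ∀ z, |z| ≤ δ → logFun Φ z ≤ M := by
  obtain ⟨M, hM⟩ := hr
  have hc : Tendsto Real.exp (𝓝 0) (𝓝 1) := by
    simpa using Real.continuous_exp.tendsto 0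
  obtain ⟨δ, hδ, h⟩ := Metric.eventually_nhds_iff.1 (hc.eventually hM)
  refine ⟨δ / 2, Real.log M, by positivity, fun z hz => ?_⟩
  have h1 : Φ (Real.exp z) ≤ M := h (by rw [dist_zero_right, Real.norm_eq_abs]; linarith)
  have h2 : Φ (Real.exp z) ≠ ∞ := ne_top_of_le_ne_top ENNReal.coe_ne_top h1
  exact Real.log_le_log (ENNReal.toReal_pos (h0 _ (Real.exp_pos z)) h2)
    (by simpa using ENNReal.toReal_mono ENNReal.coe_ne_top h1)

theorem log_eq_coe {a : ℝ≥0∞} (h0 : a ≠ 0) (ht : a ≠ ∞) :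
    ENNReal.log a = ((Real.log a.toReal : ℝ) : EReal) := ENNReal.log_pos_real h0 ht

theorem upperIndex_eq {Φ : ℝ → ℝ≥0∞} (h0 : ∀ x, 0 < x → Φ x ≠ 0) (ht : ∀ x, 0 < x → Φ x ≠ ∞)
    {b : ℝ} (hb : IsGLB ((fun y => logFun Φ y / y) '' Ioi 0) b) : upperIndex Φ = b := by
  have key : ∀ x, 1 < x → ENNReal.log (Φ x) / (Real.log x : EReal) =
      ((logFun Φ (Real.log x) / Real.log x : ℝ) : EReal) := by
    intro x hx
    have hx0 : 0 < x := one_pos.trans hx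
    rw [log_eq_coe (h0 x hx0) (ht x hx0), EReal.coe_div, logFun, Real.exp_log hx0]
  refine le_antisymm ?_ (le_iInf₂ fun x hx => ?_)
  · refine EReal.le_of_forall_lt_iff_le.1 fun c hc => ?_
    obtain ⟨_, ⟨y, hy, rfl⟩, -, hyc⟩ := hb.exists_between (EReal.coe_lt_coe_iff.1 hc)
    have hy1 : 1 < Real.exp y := Real.one_lt_exp_iff.2 hy
    refine (iInf₂_le (Real.exp y) hy1).trans ?_
    rw [key _ hy1, Real.log_exp]
    exact EReal.coe_le_coe_iff.2 hyc.le
  · rw [key x hx]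
    exact EReal.coe_le_coe_iff.2 (hb.1 (mem_image_of_mem _ (Real.log_pos hx)))

theorem lowerIndex_eq {Φ : ℝ → ℝ≥0∞} (h0 : ∀ x, 0 < x → Φ x ≠ 0) (ht : ∀ x, 0 < x → Φ x ≠ ∞)
    {b : ℝ} (hb : IsGLB ((fun y => logFun Φ (-y) / y) '' Ioi 0) b) :
    lowerIndex Φ = ((-b : ℝ) : EReal) := by
  have key : ∀ x ∈ Ioo (0 : ℝ) 1, ENNReal.log (Φ x) / (Real.log x : EReal) =
      ((-(logFun Φ (-(-Real.log x)) / -Real.log x) : ℝ) : EReal) := by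
    intro x hx
    rw [log_eq_coe (h0 x hx.1) (ht x hx.1), ← EReal.coe_div, logFun, neg_neg, Real.exp_log hx.1,
      div_neg, neg_neg]
  refine le_antisymm (iSup₂_le fun x hx => ?_) ?_
  · rw [key x hx]
    exact EReal.coe_le_coe_iff.2 (neg_le_neg (hb.1 (mem_image_of_mem _
      (neg_pos.2 (Real.log_neg hx.1 hx.2)))))
  · refine EReal.ge_of_forall_gt_iff_ge.1 fun c hc => ?_
    have hc' : b < -c := by linarith [EReal.coe_lt_coe_iff.1 hc]
    obtain ⟨_, ⟨y, hy, rfl⟩, -, hyc⟩ := hb.exists_between hc'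
    have hy1 : Real.exp (-y) ∈ Ioo (0 : ℝ) 1 :=
      ⟨Real.exp_pos _, by simpa using hy⟩
    refine le_trans ?_ (le_iSup₂ (f := fun x (_ : x ∈ Ioo (0 : ℝ) 1) =>
      ENNReal.log (Φ x) / (Real.log x : EReal)) (Real.exp (-y)) hy1)
    rw [key _ hy1, Real.log_exp, neg_neg]
    exact EReal.coe_le_coe_iff.2 (by simp only at hyc; linarith)

/-- Comparability `Φ(x) ≍ x ^ s Ψ(x)` shifts both indices by `s`; finiteness of the indices comes
from submultiplicativity together with regularity. -/
theorem exists_indices_eq_add {Φ Ψ : ℝ → ℝ≥0∞} (hΦ : IsSubmultiplicative Φ)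
    (hΨ : IsSubmultiplicative Ψ) (rΦ : IsRegular Φ) (rΨ : IsRegular Ψ)
    (h0 : ∀ x, 0 < x → Ψ x ≠ 0) (ht : ∀ x, 0 < x → Ψ x ≠ ∞) {s c C : ℝ} (hc : 0 < c)
    (hC : 0 < C) (hle : ∀ x, 0 < x → ENNReal.ofReal (c * x ^ s) * Ψ x ≤ Φ x)
    (hge : ∀ x, 0 < x → Φ x ≤ ENNReal.ofReal (C * x ^ s) * Ψ x) :
    (∃ a b : ℝ, lowerIndex Φ = a ∧ lowerIndex Ψ = b ∧ a = s + b) ∧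
      (∃ a b : ℝ, upperIndex Φ = a ∧ upperIndex Ψ = b ∧ a = s + b) := by
  have h0' : ∀ x, 0 < x → Φ x ≠ 0 := fun x hx h => by
    have h1 := hle x hx
    rw [h, nonpos_iff_eq_zero, mul_eq_zero, ENNReal.ofReal_eq_zero] at h1
    have : 0 < c * x ^ s := by positivity
    exact h1.elim (fun h => by linarith) (h0 x hx)
  have ht' : ∀ x, 0 < x → Φ x ≠ ∞ := fun x hx =>
    ne_top_of_le_ne_top (ENNReal.mul_ne_top ENNReal.ofReal_ne_top (ht x hx)) (hge x hx)
  have hlog : ∀ k, 0 < k → ∀ z, Real.log (ENNReal.ofReal (k * Real.exp z ^ s) *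
      Ψ (Real.exp z)).toReal = Real.log k + s * z + logFun Ψ z := by
    intro k hk z
    have hz := Real.exp_pos z
    have hz' : 0 < Real.exp z ^ s := by positivity
    have hp := ENNReal.toReal_pos (h0 _ hz) (ht _ hz)
    rw [ENNReal.toReal_mul, ENNReal.toReal_ofReal (by positivity),
      Real.log_mul (by positivity) hp.ne', Real.log_mul hk.ne' hz'.ne', Real.log_rpow hz,
      Real.log_exp, logFun]
  have hub : ∀ z, logFun Φ z ≤ Real.log C + s * z + logFun Ψ z := by
    intro z
    have hz := Real.exp_pos z
    rw [← hlog C hC]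
    exact Real.log_le_log (ENNReal.toReal_pos (h0' _ hz) (ht' _ hz)) (ENNReal.toReal_mono
      (ENNReal.mul_ne_top ENNReal.ofReal_ne_top (ht _ hz)) (hge _ hz))
  have hlb : ∀ z, Real.log c + s * z + logFun Ψ z ≤ logFun Φ z := by
    intro z
    have hz := Real.exp_pos z
    rw [← hlog c hc]
    refine Real.log_le_log (ENNReal.toReal_pos ?_ ?_) (ENNReal.toReal_mono (ht' _ hz) (hle _ hz))
    · have : 0 < c * Real.exp z ^ s := by positivity
      exact mul_ne_zero (by simpa using this) (h0 _ hz)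
    · exact ENNReal.mul_ne_top ENNReal.ofReal_ne_top (ht _ hz)
  obtain ⟨δ, M, hδ, hM⟩ := exists_logFun_le rΦ h0'
  obtain ⟨δ', M', hδ', hM'⟩ := exists_logFun_le rΨ h0
  have sΦ := logFun_add_le hΦ h0' ht'
  have sΨ := logFun_add_le hΨ h0 ht
  have sΦ' : ∀ x y, logFun Φ (-(x + y)) ≤ logFun Φ (-x) + logFun Φ (-y) := fun x y => by
    rw [neg_add]; exact sΦ _ _
  have sΨ' : ∀ x y, logFun Ψ (-(x + y)) ≤ logFun Ψ (-x) + logFun Ψ (-y) := fun x y => by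
    rw [neg_add]; exact sΨ _ _
  have gΦ := isGLB_growthRate sΦ hδ hM
  have gΨ := isGLB_growthRate sΨ hδ' hM'
  have gΦ' := isGLB_growthRate (g := fun z => logFun Φ (-z)) sΦ' hδ
    (fun z hz => hM _ (by rwa [abs_neg]))
  have gΨ' := isGLB_growthRate (g := fun z => logFun Ψ (-z)) sΨ' hδ'
    (fun z hz => hM' _ (by rwa [abs_neg]))
  refine ⟨⟨_, _, lowerIndex_eq h0' ht' gΦ', lowerIndex_eq h0 ht gΨ', ?_⟩,
    ⟨_, _, upperIndex_eq h0' ht' gΦ, upperIndex_eq h0 ht gΨ, le_antisymm ?_ ?_⟩⟩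
  · have h1 := growthRate_le_add (s := -s) (K := Real.log C) sΨ' gΦ' gΨ'
      fun z _ => by linarith [hub (-z)]
    have h2 := growthRate_le_add (s := s) (K := -Real.log c) sΦ' gΨ' gΦ'
      fun z _ => by linarith [hlb (-z)]
    linarith
  · exact growthRate_le_add (K := Real.log C) sΨ gΦ gΨ fun z _ => by linarith [hub z]
  · have := growthRate_le_add (s := -s) (K := -Real.log c) sΦ gΨ gΦ
      fun z _ => by linarith [hlb z]
    linarith

end Indices

/-! ### Weights in the class `A_X` at a point -/

section Weights

variable {α : Type*} [MeasurableSpace α] {ν : Measure α}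

theorem integrable_exp_log_toReal {w : α → ℝ≥0∞} (hw : AEMeasurable w ν)
    (h0 : ∀ᵐ x ∂ν, 0 < w x ∧ w x < ∞) (hi : ∫⁻ x, w x ∂ν ≠ ∞) :
    Integrable (fun x => Real.exp (Real.log (w x).toReal)) ν ∧
      ENNReal.ofReal (∫ x, Real.exp (Real.log (w x).toReal) ∂ν) = ∫⁻ x, w x ∂ν := by
  have he : (fun x => (w x).toReal) =ᵐ[ν] fun x => Real.exp (Real.log (w x).toReal) := by
    filter_upwards [h0] with x hx
    rw [Real.exp_log (ENNReal.toReal_pos hx.1.ne' hx.2.ne)]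
  refine ⟨(integrable_toReal_of_lintegral_ne_top hw hi).congr he, ?_⟩
  rw [← integral_congr_ae he, integral_toReal hw (h0.mono fun x hx => hx.2),
    ENNReal.ofReal_toReal hi]

theorem logWeight_inv (w : ℂ → ℝ≥0∞) (τ : ℂ) :
    Real.log ((w τ)⁻¹).toReal = -logWeight w τ := by
  rw [ENNReal.toReal_inv, Real.log_inv, logWeight]

variable {Γ : Set ℂ} {t : ℂ} {p : ℂ → ℝ} {w : ℂ → ℝ≥0∞}

theorem IsWeight.ae_inv (hw : IsWeight Γ w) :
    ∀ᵐ τ ∂(lengthMeasure Γ), 0 < (w τ)⁻¹ ∧ (w τ)⁻¹ < ∞ := by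
  filter_upwards [hw.2] with τ hτ
  exact ⟨ENNReal.inv_pos.2 hτ.2.ne, ENNReal.inv_lt_top.2 hτ.1⟩

theorem IsWeight.exp_logWeight (hw : IsWeight Γ w) {E : Set ℂ}
    (hi : ∫⁻ τ in E, w τ ∂(lengthMeasure Γ) ≠ ∞) :
    IntegrableOn (fun τ => Real.exp (logWeight w τ)) E (lengthMeasure Γ) ∧
      ENNReal.ofReal (∫ τ in E, Real.exp (logWeight w τ) ∂(lengthMeasure Γ)) =
        ∫⁻ τ in E, w τ ∂(lengthMeasure Γ) :=
  integrable_exp_log_toReal hw.1.restrict (ae_restrict_of_ae hw.2) hi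

theorem IsWeight.exp_neg_logWeight (hw : IsWeight Γ w) {E : Set ℂ}
    (hi : ∫⁻ τ in E, (w τ)⁻¹ ∂(lengthMeasure Γ) ≠ ∞) :
    IntegrableOn (fun τ => Real.exp (-logWeight w τ)) E (lengthMeasure Γ) ∧
      ENNReal.ofReal (∫ τ in E, Real.exp (-logWeight w τ) ∂(lengthMeasure Γ)) =
        ∫⁻ τ in E, (w τ)⁻¹ ∂(lengthMeasure Γ) := by
  have := integrable_exp_log_toReal hw.1.inv.restrict (ae_restrict_of_ae (s := E) hw.ae_inv) hi
  simp only [Pi.inv_apply, logWeight_inv] at this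
  exact this

theorem IsWeight.aestronglyMeasurable_logWeight (hw : IsWeight Γ w) :
    AEStronglyMeasurable (logWeight w) (lengthMeasure Γ) :=
  (Real.measurable_log.comp_aemeasurable hw.1.ennreal_toReal).aestronglyMeasurable

/-- Hölder's inequality against `χ_{Γ(t,R)}`, whose norms are known. -/
theorem exists_lintegral_weight_le (hΓ : IsCompact Γ) (ht : t ∈ Γ) (hC : IsLocallyCarleson Γ t)
    (hp : MemPt Γ t p) (hw : AEMeasurable w (lengthMeasure Γ)) (D : ℝ) :
    ∃ K : ℝ, 0 < K ∧ ∀ R ∈ Ioc 0 D, ∀ E, MeasurableSet E → E ⊆ portion Γ t R →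
      ∫⁻ τ in E, w τ ∂(lengthMeasure Γ) ≤
        weightNorm (nakanoNorm Γ p) w E * ENNReal.ofReal (K * R ^ (1 - 1 / p t)) ∧
      ∫⁻ τ in E, (w τ)⁻¹ ∂(lengthMeasure Γ) ≤
        invWeightNorm Γ (nakanoNorm Γ p) w E * ENNReal.ofReal (K * R ^ (1 / p t)) := by
  obtain ⟨K₁, hK₁, h₁⟩ := exists_modular_portion_le hΓ ht hC hp D
  obtain ⟨K₂, hK₂, h₂⟩ := exists_associateNorm_portion_le hΓ ht hC hp D
  have hm := fun R => measurableSet_portion (t := t) hΓ.measurableSet R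
  refine ⟨max K₁ K₂, lt_max_of_lt_left hK₁, fun R hR E hE hER => ?_⟩
  have hR0 := hR.1
  have hind : ∀ u : ℂ → ℝ≥0∞, ∫⁻ τ in E, u τ ∂(lengthMeasure Γ) =
      ∫⁻ τ, E.indicator u τ * (portion Γ t R).indicator 1 τ ∂(lengthMeasure Γ) := by
    intro u
    rw [← lintegral_indicator hE]
    refine lintegral_congr fun τ => ?_
    by_cases hτ : τ ∈ E
    · simp [hτ, hER hτ]
    · simp [hτ]
  constructor
  · rw [hind]
    have hpos : 0 < K₂ * R ^ (1 - 1 / p t) := by positivity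
    refine (lintegral_mul_le_nakanoNorm_mul (hw.indicator hE) (by simpa using hpos)
      ENNReal.ofReal_ne_top (h₂ R hR)).trans ?_
    unfold weightNorm
    gcongr
    exact le_max_right _ _
  · rw [hind]
    simp only [mul_comm (E.indicator _ _)]
    have hpos : 0 < K₁ * R ^ (1 / p t) := by positivity
    refine (lintegral_mul_le_of_modular (l := (K₁ * R ^ (1 / p t)).toNNReal)
      (measurable_one.indicator (hm R)).aemeasurable (by simpa using hpos) (h₁ R hR)).trans ?_
    rw [mul_comm]
    unfold invWeightNorm
    refine mul_le_mul' le_rfl (ENNReal.ofReal_le_ofReal ?_)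
    gcongr
    exact le_max_left _ _

theorem MemAX.exists_mul_le {ρ : (ℂ → ℝ≥0∞) → ℝ≥0∞} (hw : MemAX Γ ρ t w) :
    ∃ C : ℝ, 0 < C ∧ ∀ R, 0 < R → weightNorm ρ w (portion Γ t R) *
      invWeightNorm Γ ρ w (portion Γ t R) ≤ ENNReal.ofReal (C * R) := by
  obtain ⟨C, hC⟩ := ENNReal.lt_iff_exists_nnreal_btwn.1 hw.2
  refine ⟨C + 1, by positivity, fun R hR => ?_⟩
  have h := (le_iSup₂ (f := fun (R : ℝ) (_ : 0 < R) => weightNorm ρ w (portion Γ t R) *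
      invWeightNorm Γ ρ w (portion Γ t R) / ENNReal.ofReal R) R hR).trans hC.1.le
  rw [ENNReal.div_le_iff (by simpa using hR) ENNReal.ofReal_ne_top] at h
  refine h.trans ?_
  rw [ENNReal.ofReal_mul (by positivity)]
  gcongr
  rw [← ENNReal.ofReal_coe_nnreal]
  exact ENNReal.ofReal_le_ofReal (by linarith)

/-- A weight in the class `A_X` at `t` satisfies a Muckenhoupt `A₂` condition at `t`. -/
theorem MemAX.exists_lintegral_mul_lintegral_le (hΓ : IsCompact Γ) (ht : t ∈ Γ)
    (hC : IsLocallyCarleson Γ t) (hp : MemPt Γ t p) (hw : MemAX Γ (nakanoNorm Γ p) t w) (D : ℝ) :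
    ∃ K : ℝ, 0 < K ∧ ∀ R ∈ Ioc 0 D, (∫⁻ τ in portion Γ t R, w τ ∂(lengthMeasure Γ)) *
      (∫⁻ τ in portion Γ t R, (w τ)⁻¹ ∂(lengthMeasure Γ)) ≤ ENNReal.ofReal (K * R ^ 2) := by
  obtain ⟨K, hK, h⟩ := exists_lintegral_weight_le hΓ ht hC hp hw.1.1 D
  obtain ⟨C, hC0, hA⟩ := hw.exists_mul_le
  refine ⟨C * K ^ 2, by positivity, fun R hR => ?_⟩
  have hR0 := hR.1
  obtain ⟨h1, h2⟩ := h R hR _ (measurableSet_portion hΓ.measurableSet R) Subset.rfl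
  refine (mul_le_mul' h1 h2).trans ?_
  rw [mul_mul_mul_comm, ← ENNReal.ofReal_mul (by positivity)]
  refine (mul_le_mul' (hA R hR0) le_rfl).trans_eq ?_
  rw [← ENNReal.ofReal_mul (by positivity)]
  congr 1
  have e : R ^ (1 - 1 / p t) * R ^ (1 / p t) = R := by
    rw [← Real.rpow_add hR0, sub_add_cancel, Real.rpow_one]
  calc _ = C * K ^ 2 * R * (R ^ (1 - 1 / p t) * R ^ (1 / p t)) := by ring
    _ = _ := by rw [e]; ring

theorem lintegral_restrict_ne_zero {u : ℂ → ℝ≥0∞} {μ : Measure ℂ} (hu : AEMeasurable u μ)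
    (h0 : ∀ᵐ τ ∂μ, 0 < u τ) {E : Set ℂ} (hE : μ E ≠ 0) : ∫⁻ τ in E, u τ ∂μ ≠ 0 := by
  intro h
  rw [lintegral_eq_zero_iff' hu.restrict] at h
  have : ∀ᵐ τ ∂(μ.restrict E), False := by
    filter_upwards [h, ae_restrict_of_ae h0] with τ h1 h2
    exact h2.ne' h1
  rw [eventually_false_iff_eq_bot, ae_eq_bot, Measure.restrict_eq_zero] at this
  exact hE this

/-- The exponentials `w` and `1/w` of `± log w` are integrable over every `Γ(t,R)`, and the
`A₂` condition bounds the oscillation of `log w`. -/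
theorem MemAX.exists_oscillation_le (hΓ : IsCompact Γ) (hc : IsPreconnected Γ) (ht : t ∈ Γ)
    (hC : IsLocallyCarleson Γ t) (hp : MemPt Γ t p) (hw : MemAX Γ (nakanoNorm Γ p) t w) :
    ∃ B : ℝ, 0 < B ∧ ∀ R ∈ Ioc 0 (2 * maxDist Γ t),
      ∫⁻ τ in portion Γ t R, w τ ∂(lengthMeasure Γ) ≠ ∞ ∧
      ∫⁻ τ in portion Γ t R, (w τ)⁻¹ ∂(lengthMeasure Γ) ≠ ∞ ∧
      IntegrableOn (logWeight w) (portion Γ t R) (lengthMeasure Γ) ∧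
      ∫ τ in portion Γ t R, |logWeight w τ - mean Γ t (logWeight w) R| ∂(lengthMeasure Γ)
        ≤ B * R := by
  have := isFiniteMeasure_lengthMeasure hΓ hC
  obtain ⟨K, hK, h⟩ := hw.exists_lintegral_mul_lintegral_le hΓ ht hC hp (2 * maxDist Γ t)
  refine ⟨8 * K, by positivity, fun R hR => ?_⟩
  have hR0 := hR.1
  have hm := quarter_le_measure_portion hΓ hc ht hR.1 hR.2
  have hm0 : lengthMeasure Γ (portion Γ t R) ≠ 0 := by
    intro h0
    rw [h0, nonpos_iff_eq_zero, ENNReal.ofReal_eq_zero] at hm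
    linarith
  have hmr : R / 4 ≤ (lengthMeasure Γ).real (portion Γ t R) :=
    (ENNReal.ofReal_le_iff_le_toReal (measure_ne_top _ _)).1 hm
  have hK' := h R hR
  have hwi := lintegral_restrict_ne_zero hw.1.1 (hw.1.2.mono fun _ h => h.1) hm0
  have hwi' := lintegral_restrict_ne_zero hw.1.1.inv (hw.1.ae_inv.mono fun _ h => h.1) hm0
  have hne := ne_top_of_le_ne_top ENNReal.ofReal_ne_top hK'
  have hf1 : ∫⁻ τ in portion Γ t R, w τ ∂(lengthMeasure Γ) ≠ ∞ := fun h1 =>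
    hne (by rw [h1]; exact ENNReal.top_mul hwi')
  have hf2 : ∫⁻ τ in portion Γ t R, (w τ)⁻¹ ∂(lengthMeasure Γ) ≠ ∞ := fun h1 =>
    hne (by rw [h1]; exact ENNReal.mul_top hwi)
  obtain ⟨i1, e1⟩ := hw.1.exp_logWeight hf1
  obtain ⟨i2, e2⟩ := hw.1.exp_neg_logWeight hf2
  have hmeas := hw.1.aestronglyMeasurable_logWeight.restrict (s := portion Γ t R)
  have : NeZero ((lengthMeasure Γ).restrict (portion Γ t R)) :=
    ⟨fun h0 => hm0 (Measure.restrict_eq_zero.1 h0)⟩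
  refine ⟨hf1, hf2, integrable_of_integrable_exp hmeas i1 i2, ?_⟩
  refine (integral_abs_sub_average_le hmeas i1 i2).trans ?_
  rw [measureReal_restrict_apply_univ]
  have hle : (∫ τ in portion Γ t R, Real.exp (logWeight w τ) ∂(lengthMeasure Γ)) *
      (∫ τ in portion Γ t R, Real.exp (-logWeight w τ) ∂(lengthMeasure Γ)) ≤ K * R ^ 2 := by
    rw [← e1, ← e2, ← ENNReal.ofReal_mul (integral_nonneg fun _ => (Real.exp_pos _).le)] at hK'
    exact (ENNReal.ofReal_le_ofReal_iff (by positivity)).1 hK'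
  calc _ ≤ 2 * (K * R ^ 2) / (R / 4) := by gcongr
    _ = 8 * K * R := by field_simp; ring

theorem mem_Ioc_or_portion_eq (hΓ : IsRectifiableJordanCurve Γ) {R : ℝ} (hR : 0 < R) :
    ∃ S ∈ Ioc 0 (2 * maxDist Γ t), portion Γ t R = portion Γ t S := by
  have hd := maxDist_pos hΓ t
  rcases le_or_gt R (2 * maxDist Γ t) with h | h
  · exact ⟨R, ⟨hR, h⟩, rfl⟩
  · refine ⟨2 * maxDist Γ t, ⟨by linarith, le_rfl⟩, ?_⟩
    rw [portion_eq_self hΓ.isCompact (by linarith), portion_eq_self hΓ.isCompact (by linarith)]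

theorem MemAX.memBMO_logWeight (hΓ : IsRectifiableJordanCurve Γ) (ht : t ∈ Γ)
    (hC : IsLocallyCarleson Γ t) (hp : MemPt Γ t p) (hw : MemAX Γ (nakanoNorm Γ p) t w) :
    MemBMO Γ t (logWeight w) := by
  have := isFiniteMeasure_lengthMeasure hΓ.isCompact hC
  have hd := maxDist_pos hΓ t
  obtain ⟨B, hB, h⟩ := hw.exists_oscillation_le hΓ.isCompact hΓ.isPreconnected ht hC hp
  refine ⟨?_, ?_⟩
  · have h1 := (h (2 * maxDist Γ t) ⟨by linarith, le_rfl⟩).2.2.1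
    rw [portion_eq_self hΓ.isCompact (by linarith), IntegrableOn, lengthMeasure,
      Measure.restrict_restrict hΓ.isCompact.measurableSet, inter_self] at h1
    exact h1
  · refine lt_of_le_of_lt (iSup₂_le fun R hR => ?_) (ENNReal.ofReal_lt_top (r := 4 * B))
    obtain ⟨S, hS, hRS⟩ := mem_Ioc_or_portion_eq (t := t) hΓ hR
    have hmean : mean Γ t (logWeight w) R = mean Γ t (logWeight w) S := by
      rw [mean, mean, hRS]
    rw [hRS, hmean]
    obtain ⟨-, -, hi, ho⟩ := h S hS
    have hS0 := hS.1
    have hi' : Integrable (fun τ => logWeight w τ - mean Γ t (logWeight w) S)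
        ((lengthMeasure Γ).restrict (portion Γ t S)) := hi.sub (integrable_const _)
    rw [← ofReal_integral_norm_eq_lintegral_enorm hi']
    refine ENNReal.div_le_of_le_mul ?_
    calc _ ≤ ENNReal.ofReal (B * S) := ENNReal.ofReal_le_ofReal ho
      _ = ENNReal.ofReal (4 * B) * ENNReal.ofReal (S / 4) := by
        rw [← ENNReal.ofReal_mul (by positivity)]; congr 1; ring
      _ ≤ _ := by
        gcongr
        exact quarter_le_measure_portion hΓ.isCompact hΓ.isPreconnected ht hS.1 hS.2

/-- Means of `log w` over portions of comparable radii differ by a bounded amount. -/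
theorem MemAX.exists_abs_mean_sub_le (hΓ : IsRectifiableJordanCurve Γ) (ht : t ∈ Γ)
    (hC : IsLocallyCarleson Γ t) (hp : MemPt Γ t p) (hw : MemAX Γ (nakanoNorm Γ p) t w) :
    ∃ B : ℝ, 0 < B ∧ ∀ R₁ ∈ Ioc 0 (maxDist Γ t), ∀ R₂ ∈ Ioc 0 (maxDist Γ t),
      |mean Γ t (logWeight w) R₁ - mean Γ t (logWeight w) R₂| ≤
        B * (R₁ / R₂ + (R₁ / R₂)⁻¹) := by
  have := isFiniteMeasure_lengthMeasure hΓ.isCompact hC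
  have hd := maxDist_pos hΓ t
  obtain ⟨B, hB, h⟩ := hw.exists_oscillation_le hΓ.isCompact hΓ.isPreconnected ht hC hp
  have key : ∀ R₁ ∈ Ioc 0 (maxDist Γ t), ∀ R₂ ∈ Ioc 0 (maxDist Γ t), R₁ ≤ R₂ →
      |mean Γ t (logWeight w) R₁ - mean Γ t (logWeight w) R₂| ≤ 4 * B * (R₂ / R₁) := by
    intro R₁ h₁ R₂ h₂ hle
    obtain ⟨-, -, hi, ho⟩ := h R₂ ⟨h₂.1, by linarith [h₂.2]⟩
    have hR0 := h₁.1
    have hm := quarter_le_measure_portion hΓ.isCompact hΓ.isPreconnected ht h₁.1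
      (by linarith [h₁.2] : R₁ ≤ 2 * maxDist Γ t)
    have hmp := measurableSet_portion (t := t) hΓ.isCompact.measurableSet R₁
    have hrr : ((lengthMeasure Γ).restrict (portion Γ t R₂)).restrict (portion Γ t R₁) =
        (lengthMeasure Γ).restrict (portion Γ t R₁) :=
      Measure.restrict_restrict_of_subset (portion_mono hle)
    have := abs_average_sub_le (E := portion Γ t R₁) (c := R₁ / 4) hi (by positivity) (by
      rw [measureReal_def, Measure.restrict_apply hmp, inter_eq_left.2 (portion_mono hle)]
      exact (ENNReal.ofReal_le_iff_le_toReal (measure_ne_top _ _)).1 hm) ho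
    rw [hrr] at this
    refine this.trans_eq ?_
    field_simp
  refine ⟨4 * B, by positivity, fun R₁ h₁ R₂ h₂ => ?_⟩
  have p1 : 0 < R₁ / R₂ := div_pos h₁.1 h₂.1
  have p2 : 0 < R₂ / R₁ := div_pos h₂.1 h₁.1
  rw [inv_div]
  rcases le_total R₁ R₂ with hle | hle
  · refine (key R₁ h₁ R₂ h₂ hle).trans ?_
    gcongr; linarith
  · rw [abs_sub_comm]
    refine (key R₂ h₂ R₁ h₁ hle).trans ?_
    gcongr; linarith

theorem ofReal_div_le_of_le_mul {a : ℝ≥0∞} {x y : ℝ} (hy : 0 < y)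
    (h : ENNReal.ofReal x ≤ a * ENNReal.ofReal y) : ENNReal.ofReal (x / y) ≤ a := by
  rw [ENNReal.ofReal_div_of_pos hy]
  exact ENNReal.div_le_of_le_mul h

theorem le_ofReal_div_of_mul_le {a b : ℝ≥0∞} {y z : ℝ} (hy : 0 < y)
    (hb : ENNReal.ofReal y ≤ b) (h : a * b ≤ ENNReal.ofReal z) : a ≤ ENNReal.ofReal (z / y) := by
  rw [ENNReal.ofReal_div_of_pos hy, ENNReal.le_div_iff_mul_le (by simp [hy]) (by simp)]
  exact (mul_le_mul' le_rfl hb).trans h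

theorem weightNorm_mono (hΓ : MeasurableSet Γ) (hp : MemPt Γ t p) {E F : Set ℂ} (h : E ⊆ F) :
    weightNorm (nakanoNorm Γ p) w E ≤ weightNorm (nakanoNorm Γ p) w F :=
  nakanoNorm_mono hΓ (fun τ hτ => (zero_lt_one.trans (hp.2.1 τ hτ)).le)
    fun τ => indicator_le_indicator_of_subset h (fun _ => zero_le) τ

theorem invWeightNorm_mono {ρ : (ℂ → ℝ≥0∞) → ℝ≥0∞} {E F : Set ℂ} (h : E ⊆ F) :
    invWeightNorm Γ ρ w E ≤ invWeightNorm Γ ρ w F :=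
  associateNorm_mono Γ ρ fun τ => indicator_le_indicator_of_subset h (fun _ => zero_le) τ

/-- The norms over `Δ(t,R)` are comparable with `e ^ (± Ω)` times powers of `R`. The lower bounds
come from Jensen's inequality on `Δ(t,R)`; each upper bound follows from the lower bound of the
other factor, the product being at most a multiple of `R`. -/
theorem MemAX.exists_annulus_bounds (hΓ : IsRectifiableJordanCurve Γ) (ht : t ∈ Γ)
    (hC : IsLocallyCarleson Γ t) (hp : MemPt Γ t p) (hw : MemAX Γ (nakanoNorm Γ p) t w) :
    ∃ c C : ℝ, 0 < c ∧ 0 < C ∧ ∀ R ∈ Ioc 0 (maxDist Γ t),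
      ENNReal.ofReal (c * (Real.exp (mean Γ t (logWeight w) R) * R ^ (1 / p t))) ≤
        weightNorm (nakanoNorm Γ p) w (annulus Γ t R) ∧
      weightNorm (nakanoNorm Γ p) w (annulus Γ t R) ≤
        ENNReal.ofReal (C * (Real.exp (mean Γ t (logWeight w) R) * R ^ (1 / p t))) ∧
      ENNReal.ofReal (c * (R / (Real.exp (mean Γ t (logWeight w) R) * R ^ (1 / p t)))) ≤
        invWeightNorm Γ (nakanoNorm Γ p) w (annulus Γ t R) ∧
      invWeightNorm Γ (nakanoNorm Γ p) w (annulus Γ t R) ≤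
        ENNReal.ofReal (C * (R / (Real.exp (mean Γ t (logWeight w) R) * R ^ (1 / p t)))) := by
  have := isFiniteMeasure_lengthMeasure hΓ.isCompact hC
  have hd := maxDist_pos hΓ t
  have hΓm := hΓ.isCompact.measurableSet
  obtain ⟨B, hB, hosc⟩ := hw.exists_oscillation_le hΓ.isCompact hΓ.isPreconnected ht hC hp
  obtain ⟨K, hK, hK'⟩ := exists_lintegral_weight_le hΓ.isCompact ht hC hp hw.1.1 (maxDist Γ t)
  obtain ⟨A, hA, hA'⟩ := hw.exists_mul_le
  set c := Real.exp (-(2 * B)) / (2 * K) with hc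
  have hc0 : 0 < c := by positivity
  refine ⟨c, A / c, hc0, by positivity, fun R hR => ?_⟩
  have hR0 := hR.1
  obtain ⟨hf1, hf2, hi, ho⟩ := hosc R ⟨hR.1, by linarith [hR.2]⟩
  obtain ⟨hk1, hk2⟩ := hK' R hR _ (measurableSet_annulus hΓm R) (annulus_subset_portion R)
  set m := mean Γ t (logWeight w) R with hm
  set X := Real.exp m * R ^ (1 / p t) with hX
  have hX0 : 0 < X := by positivity
  set a := weightNorm (nakanoNorm Γ p) w (annulus Γ t R)
  set b := invWeightNorm Γ (nakanoNorm Γ p) w (annulus Γ t R)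
  have hsub : annulus Γ t R ⊆ portion Γ t R := annulus_subset_portion R
  have hrr : ((lengthMeasure Γ).restrict (portion Γ t R)).restrict (annulus Γ t R) =
      (lengthMeasure Γ).restrict (annulus Γ t R) := Measure.restrict_restrict_of_subset hsub
  have hmE : R / 2 ≤ (lengthMeasure Γ).real (annulus Γ t R) :=
    (ENNReal.ofReal_le_iff_le_toReal (measure_ne_top _ _)).1
      (half_le_measure_annulus hΓ.isCompact hΓ.isPreconnected ht hR.1 hR.2)
  have hNe : NeZero ((lengthMeasure Γ).restrict (annulus Γ t R)) := ⟨fun h0 => by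
    rw [measureReal_def, Measure.restrict_eq_zero.1 h0, ENNReal.toReal_zero] at hmE; linarith⟩
  have hav := abs_average_sub_le (E := annulus Γ t R) (c := R / 2) hi (by positivity) (by
    rw [measureReal_def, Measure.restrict_apply (measurableSet_annulus hΓm R),
      inter_eq_left.2 hsub]
    exact hmE) ho
  rw [hrr, (by field_simp : B * R / (R / 2) = 2 * B)] at hav
  obtain ⟨hav1, hav2⟩ := abs_le.1 hav
  have hrest := Measure.restrict_mono (μ := lengthMeasure Γ) (ν := lengthMeasure Γ) hsub le_rfl
  obtain ⟨i1, e1⟩ := hw.1.exp_logWeight (ne_top_of_le_ne_top hf1 (lintegral_mono' hrest le_rfl))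
  obtain ⟨i2, e2⟩ := hw.1.exp_neg_logWeight
    (ne_top_of_le_ne_top hf2 (lintegral_mono' hrest le_rfl))
  have hiE := hi.mono_set hsub
  have j1 := mul_exp_average_le hiE i1
  have j2 := mul_exp_average_le hiE.neg i2
  simp only [Pi.neg_apply, measureReal_restrict_apply_univ] at j1 j2
  rw [average_neg] at j2
  have e : R ^ (1 - 1 / p t) * R ^ (1 / p t) = R := by
    rw [← Real.rpow_add hR0, sub_add_cancel, Real.rpow_one]
  have la : ENNReal.ofReal (c * X) ≤ a := by
    have h1 : R / 2 * (Real.exp m * Real.exp (-(2 * B))) ≤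
        ∫ τ in annulus Γ t R, Real.exp (logWeight w τ) ∂(lengthMeasure Γ) := by
      refine le_trans ?_ j1
      rw [← Real.exp_add]
      gcongr
      linarith
    have h2 := ofReal_div_le_of_le_mul (by positivity)
      ((ENNReal.ofReal_le_ofReal h1).trans (e1.le.trans hk1))
    refine le_of_eq_of_le ?_ h2
    congr 1
    rw [hc, hX, eq_div_iff (by positivity)]
    calc _ = Real.exp (-(2 * B)) / 2 * Real.exp m * (R ^ (1 - 1 / p t) * R ^ (1 / p t)) := by
          field_simp
      _ = _ := by rw [e]; ring
  have lb : ENNReal.ofReal (c * (R / X)) ≤ b := by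
    have h1 : R / 2 * (Real.exp (-m) * Real.exp (-(2 * B))) ≤
        ∫ τ in annulus Γ t R, Real.exp (-logWeight w τ) ∂(lengthMeasure Γ) := by
      refine le_trans ?_ j2
      rw [← Real.exp_add]
      gcongr
      linarith
    have h2 := ofReal_div_le_of_le_mul (by positivity)
      ((ENNReal.ofReal_le_ofReal h1).trans (e2.le.trans hk2))
    refine le_of_eq_of_le ?_ h2
    congr 1
    rw [hc, hX, Real.exp_neg m]
    field_simp
  have hab : a * b ≤ ENNReal.ofReal (A * R) :=
    (mul_le_mul' (weightNorm_mono hΓm hp hsub) (invWeightNorm_mono hsub)).trans (hA' R hR0)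
  refine ⟨la, ?_, lb, ?_⟩
  · refine (le_ofReal_div_of_mul_le (by positivity) lb hab).trans_eq ?_
    congr 1; field_simp
  · refine (le_ofReal_div_of_mul_le (by positivity) la (mul_comm a b ▸ hab)).trans_eq ?_
    congr 1; field_simp

end Weights

/-! ### The functions `V_t w` and `Q_t w` -/

section Comparison

variable {Γ : Set ℂ} {t : ℂ} {p : ℂ → ℝ} {w : ℂ → ℝ≥0∞}

theorem isRegular_of_le {Φ : ℝ → ℝ≥0∞} {g : ℝ → ℝ} (hg : ContinuousAt g 1)
    (h : ∀ x, 0 < x → Φ x ≤ ENNReal.ofReal (g x)) : IsRegular Φ := by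
  refine ⟨(g 1 + 1).toNNReal, ?_⟩
  filter_upwards [hg.eventually_lt continuousAt_const (lt_add_one (g 1)),
    eventually_gt_nhds one_pos] with x hx hx0
  exact (h x hx0).trans (ENNReal.ofReal_le_ofReal hx.le)

theorem isSubmultiplicative_fnV (Γ : Set ℂ) (t : ℂ) (w : ℂ → ℝ≥0∞) :
    IsSubmultiplicative (fnV Γ t w) := by
  refine isSubmultiplicative_supRatio fun R₁ _ R₂ _ R₃ _ => ?_
  rw [fnH, fnH, fnH, ← ENNReal.ofReal_mul (by positivity)]
  rw [div_mul_div_cancel₀ (Real.exp_pos _).ne']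

theorem fnV_ne_zero (hΓ : IsRectifiableJordanCurve Γ) (x : ℝ) : fnV Γ t w x ≠ 0 := by
  have hd := maxDist_pos hΓ t
  have hpos : ∀ R₁ R₂, 0 < fnH Γ t w R₁ R₂ := fun R₁ R₂ => by
    rw [fnH, ENNReal.ofReal_pos]; positivity
  rw [fnV, supRatio]
  split_ifs
  · exact ((hpos _ _).trans_le (le_iSup₂ (f := fun R (_ : R ∈ Ioc 0 (maxDist Γ t)) =>
      fnH Γ t w (x * R) R) (maxDist Γ t) ⟨hd, le_rfl⟩)).ne'
  · exact ((hpos _ _).trans_le (le_iSup₂ (f := fun R (_ : R ∈ Ioc 0 (maxDist Γ t)) =>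
      fnH Γ t w R (x⁻¹ * R)) (maxDist Γ t) ⟨hd, le_rfl⟩)).ne'

theorem MemAX.exists_fnV_le (hΓ : IsRectifiableJordanCurve Γ) (ht : t ∈ Γ)
    (hC : IsLocallyCarleson Γ t) (hp : MemPt Γ t p) (hw : MemAX Γ (nakanoNorm Γ p) t w) :
    ∃ B : ℝ, ∀ x, 0 < x → fnV Γ t w x ≤ ENNReal.ofReal (Real.exp (B * (x + x⁻¹))) := by
  obtain ⟨B, -, hB⟩ := hw.exists_abs_mean_sub_le hΓ ht hC hp
  refine ⟨B, fun x hx => ?_⟩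
  have h := supRatio_le_mul (d := maxDist Γ t) (F := fnH Γ t w) (F' := fun _ _ => 1)
    (c := fun x => ENNReal.ofReal (Real.exp (B * (x + x⁻¹)))) (fun R₁ h₁ R₂ h₂ => by
      rw [mul_one, fnH, ← Real.exp_sub]
      exact ENNReal.ofReal_le_ofReal (Real.exp_le_exp.2 ((le_abs_self _).trans (hB R₁ h₁ R₂ h₂))))
    hx
  refine h.trans ((mul_le_mul' le_rfl ?_).trans_eq (mul_one _))
  rw [supRatio]
  split_ifs <;> exact iSup₂_le fun _ _ => le_rfl

/-- `G_w(R₁,R₂)` is comparable with `(R₁/R₂) ^ (1/p(t)) H_w(R₁,R₂)`. -/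
theorem MemAX.exists_fnG_bounds (hΓ : IsRectifiableJordanCurve Γ) (ht : t ∈ Γ)
    (hC : IsLocallyCarleson Γ t) (hp : MemPt Γ t p) (hw : MemAX Γ (nakanoNorm Γ p) t w) :
    ∃ c C : ℝ, 0 < c ∧ 0 < C ∧ ∀ R₁ ∈ Ioc 0 (maxDist Γ t), ∀ R₂ ∈ Ioc 0 (maxDist Γ t),
      ENNReal.ofReal (c * (R₁ / R₂) ^ (1 / p t)) * fnH Γ t w R₁ R₂ ≤
        fnG Γ (nakanoNorm Γ p) t w R₁ R₂ ∧
      fnG Γ (nakanoNorm Γ p) t w R₁ R₂ ≤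
        ENNReal.ofReal (C * (R₁ / R₂) ^ (1 / p t)) * fnH Γ t w R₁ R₂ := by
  obtain ⟨c, C, hc, hC0, h⟩ := hw.exists_annulus_bounds hΓ ht hC hp
  obtain ⟨A, hA, hA'⟩ := hC.exists_measure_portion_le
  refine ⟨c * c / A, C * C * 2, by positivity, by positivity, fun R₁ h₁ R₂ h₂ => ?_⟩
  obtain ⟨la, ua, -, -⟩ := h R₁ h₁
  obtain ⟨-, -, lb, ub⟩ := h R₂ h₂
  have p1 := h₁.1
  have p2 := h₂.1
  have hm1 := half_le_measure_annulus hΓ.isCompact hΓ.isPreconnected ht h₂.1 h₂.2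
  have hm2 : lengthMeasure Γ (annulus Γ t R₂) ≤ ENNReal.ofReal (A * R₂) :=
    (measure_mono (annulus_subset_portion R₂)).trans (hA' R₂ p2)
  constructor
  · calc _ = ENNReal.ofReal (c * (Real.exp (mean Γ t (logWeight w) R₁) * R₁ ^ (1 / p t))) *
          ENNReal.ofReal (c * (R₂ / (Real.exp (mean Γ t (logWeight w) R₂) * R₂ ^ (1 / p t)))) /
          ENNReal.ofReal (A * R₂) := by
          rw [fnH, ← ENNReal.ofReal_mul (by positivity), ← ENNReal.ofReal_mul (by positivity),
            ← ENNReal.ofReal_div_of_pos (by positivity), Real.div_rpow p1.le p2.le]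
          congr 1; field_simp
      _ ≤ _ := ENNReal.div_le_div (mul_le_mul' la lb) hm2
  · calc _ ≤ ENNReal.ofReal (C * (Real.exp (mean Γ t (logWeight w) R₁) * R₁ ^ (1 / p t))) *
          ENNReal.ofReal (C * (R₂ / (Real.exp (mean Γ t (logWeight w) R₂) * R₂ ^ (1 / p t)))) /
          ENNReal.ofReal (R₂ / 2) := ENNReal.div_le_div (mul_le_mul' ua ub) hm1
      _ = _ := by
          rw [fnH, ← ENNReal.ofReal_mul (by positivity), ← ENNReal.ofReal_mul (by positivity),
            ← ENNReal.ofReal_div_of_pos (by positivity), Real.div_rpow p1.le p2.le]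
          congr 1; field_simp

/-- Hölder's inequality gives `|Δ(t,R₂)| ≤ ‖w χ_{Δ(t,R₂)}‖ ‖χ_{Δ(t,R₂)} / w‖'`, so that inserting
an intermediate radius `R₂` can only increase the product. -/
theorem MemAX.isSubmultiplicative_fnQ (hΓ : IsRectifiableJordanCurve Γ) (ht : t ∈ Γ)
    (hC : IsLocallyCarleson Γ t) (hp : MemPt Γ t p) (hw : MemAX Γ (nakanoNorm Γ p) t w) :
    IsSubmultiplicative (fnQ Γ (nakanoNorm Γ p) t w) := by
  have := isFiniteMeasure_lengthMeasure hΓ.isCompact hC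
  have hΓm := hΓ.isCompact.measurableSet
  obtain ⟨c, C, hc, hC0, h⟩ := hw.exists_annulus_bounds hΓ ht hC hp
  refine isSubmultiplicative_supRatio fun R₁ _ R₂ h₂ R₃ _ => ?_
  obtain ⟨-, -, lb, ub⟩ := h R₂ h₂
  have p2 := h₂.1
  have hE := measurableSet_annulus (t := t) hΓm R₂
  have hb0 : invWeightNorm Γ (nakanoNorm Γ p) w (annulus Γ t R₂) ≠ 0 :=
    ((ENNReal.ofReal_pos.2 (by positivity)).trans_le lb).ne'
  have hbt : invWeightNorm Γ (nakanoNorm Γ p) w (annulus Γ t R₂) ≠ ∞ :=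
    ne_top_of_le_ne_top ENNReal.ofReal_ne_top ub
  have hm0 : lengthMeasure Γ (annulus Γ t R₂) ≠ 0 :=
    ((ENNReal.ofReal_pos.2 (by positivity)).trans_le (half_le_measure_annulus hΓ.isCompact
      hΓ.isPreconnected ht h₂.1 h₂.2)).ne'
  have hmt : lengthMeasure Γ (annulus Γ t R₂) ≠ ∞ := measure_ne_top _ _
  have key : lengthMeasure Γ (annulus Γ t R₂) ≤ weightNorm (nakanoNorm Γ p) w (annulus Γ t R₂) *
      invWeightNorm Γ (nakanoNorm Γ p) w (annulus Γ t R₂) := by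
    refine le_trans ?_ (lintegral_mul_le_nakanoNorm_mul (hw.1.1.indicator hE) hb0 hbt le_rfl)
    rw [← lintegral_indicator_one hE]
    refine lintegral_mono_ae ?_
    filter_upwards [hw.1.2] with τ hτ
    by_cases hmem : τ ∈ annulus Γ t R₂
    · simp [hmem, ENNReal.mul_inv_cancel hτ.1.ne' hτ.2.ne]
    · simp [hmem]
  simp only [fnG]
  set a₁ := weightNorm (nakanoNorm Γ p) w (annulus Γ t R₁)
  set a₂ := weightNorm (nakanoNorm Γ p) w (annulus Γ t R₂)
  set b₂ := invWeightNorm Γ (nakanoNorm Γ p) w (annulus Γ t R₂)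
  set b₃ := invWeightNorm Γ (nakanoNorm Γ p) w (annulus Γ t R₃)
  set m₂ := lengthMeasure Γ (annulus Γ t R₂)
  calc a₁ * b₃ / lengthMeasure Γ (annulus Γ t R₃)
      = m₂ / m₂ * (a₁ * b₃ / lengthMeasure Γ (annulus Γ t R₃)) := by
        rw [ENNReal.div_self hm0 hmt, one_mul]
    _ ≤ a₂ * b₂ / m₂ * (a₁ * b₃ / lengthMeasure Γ (annulus Γ t R₃)) := by gcongr
    _ = _ := by simp only [div_eq_mul_inv]; ring

end Comparison

end NakanoCurve

theorem mainTheorem4 (Γ : Set ℂ) (hΓ : NakanoCurve.IsRectifiableJordanCurve Γ)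
    (t : ℂ) (ht : t ∈ Γ) (hC : NakanoCurve.IsLocallyCarleson Γ t)
    (p : ℂ → ℝ) (hp : NakanoCurve.MemPt Γ t p)
    (w : ℂ → ℝ≥0∞) (hw : NakanoCurve.MemAX Γ (NakanoCurve.nakanoNorm Γ p) t w) :
    NakanoCurve.MemBMO Γ t (NakanoCurve.logWeight w) ∧
    (NakanoCurve.IsRegular (NakanoCurve.fnQ Γ (NakanoCurve.nakanoNorm Γ p) t w) ∧
      NakanoCurve.IsSubmultiplicative (NakanoCurve.fnQ Γ (NakanoCurve.nakanoNorm Γ p) t w)) ∧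
    (NakanoCurve.IsRegular (NakanoCurve.fnV Γ t w) ∧
      NakanoCurve.IsSubmultiplicative (NakanoCurve.fnV Γ t w)) ∧
    (∃ αQ αV : ℝ,
      NakanoCurve.lowerIndex (NakanoCurve.fnQ Γ (NakanoCurve.nakanoNorm Γ p) t w) = αQ ∧
      NakanoCurve.lowerIndex (NakanoCurve.fnV Γ t w) = αV ∧
      αQ = 1 / p t + αV) ∧
    (∃ βQ βV : ℝ,
      NakanoCurve.upperIndex (NakanoCurve.fnQ Γ (NakanoCurve.nakanoNorm Γ p) t w) = βQ ∧
      NakanoCurve.upperIndex (NakanoCurve.fnV Γ t w) = βV ∧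
      βQ = 1 / p t + βV) := by
  obtain ⟨B, hB⟩ := hw.exists_fnV_le hΓ ht hC hp
  obtain ⟨c, C, hc, hC0, h⟩ := hw.exists_fnG_bounds hΓ ht hC hp
  have hge : ∀ x, 0 < x → NakanoCurve.fnQ Γ (NakanoCurve.nakanoNorm Γ p) t w x ≤
      ENNReal.ofReal (C * x ^ (1 / p t)) * NakanoCurve.fnV Γ t w x := fun x hx =>
    NakanoCurve.supRatio_le_mul (c := fun x => ENNReal.ofReal (C * x ^ (1 / p t)))
      (fun R₁ h₁ R₂ h₂ => (h R₁ h₁ R₂ h₂).2) hx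
  have hle : ∀ x, 0 < x → ENNReal.ofReal (c * x ^ (1 / p t)) * NakanoCurve.fnV Γ t w x ≤
      NakanoCurve.fnQ Γ (NakanoCurve.nakanoNorm Γ p) t w x := fun x hx => by
    have hpos : 0 < c * x ^ (1 / p t) := by positivity
    rw [mul_comm, ← ENNReal.le_div_iff_mul_le (Or.inl (ENNReal.ofReal_pos.2 hpos).ne')
      (Or.inl ENNReal.ofReal_ne_top), ENNReal.div_eq_inv_mul]
    refine NakanoCurve.supRatio_le_mul (c := fun x => (ENNReal.ofReal (c * x ^ (1 / p t)))⁻¹)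
      (fun R₁ h₁ R₂ h₂ => ?_) hx
    have hpos' : 0 < c * (R₁ / R₂) ^ (1 / p t) :=
      mul_pos hc (Real.rpow_pos_of_pos (div_pos h₁.1 h₂.1) _)
    rw [← ENNReal.div_eq_inv_mul,
      ENNReal.le_div_iff_mul_le (Or.inl (ENNReal.ofReal_pos.2 hpos').ne')
      (Or.inl ENNReal.ofReal_ne_top), mul_comm]
    exact (h R₁ h₁ R₂ h₂).1
  have rV : NakanoCurve.IsRegular (NakanoCurve.fnV Γ t w) :=
    NakanoCurve.isRegular_of_le (g := fun x => Real.exp (B * (x + x⁻¹)))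
      (by fun_prop (disch := norm_num)) hB
  have rQ : NakanoCurve.IsRegular (NakanoCurve.fnQ Γ (NakanoCurve.nakanoNorm Γ p) t w) := by
    refine NakanoCurve.isRegular_of_le
      (g := fun x => C * x ^ (1 / p t) * Real.exp (B * (x + x⁻¹))) ?_ fun x hx => ?_
    · exact (continuousAt_const.mul (Real.continuousAt_rpow_const 1 _ (Or.inl one_ne_zero))).mul
        (by fun_prop (disch := norm_num))
    · rw [ENNReal.ofReal_mul (by positivity)]
      exact (hge x hx).trans (mul_le_mul' le_rfl (hB x hx))
  have sQ := hw.isSubmultiplicative_fnQ hΓ ht hC hp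
  have sV := NakanoCurve.isSubmultiplicative_fnV Γ t w
  exact ⟨hw.memBMO_logWeight hΓ ht hC hp, ⟨rQ, sQ⟩, ⟨rV, sV⟩,
    NakanoCurve.exists_indices_eq_add sQ sV rQ rV (fun x _ => NakanoCurve.fnV_ne_zero hΓ x)
      (fun x hx => ne_top_of_le_ne_top ENNReal.ofReal_ne_top (hB x hx)) hc hC0 hle hge⟩
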